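/- Let $F:\mathbb{R}^n\times\Xi\to\mathbb{R}$ be jointly measurable, let $P$ be a probability distribution on $\Xi$, and let $F(x,\cdot)$ be $P$-integrable for every $x$; put $f(x)=\mathbb{E}_{\xi\sim P}[F(x;\xi)]$. Assume that $F$ is Lipschitz in mean square, $\mathbb{E}_\xi|F(x;\xi)-F(y;\xi)|^2\le L_0^2\|x-y\|^2$ for all $x,y$ (so that $f$ is $L_0$-Lipschitz), that $f$ is $\rho$-weakly convex, i.e. $f+\frac{\rho}{2}\|\cdot\|^2$ is convex, with $\rho>0$, that $r:\mathbb{R}^n\to\mathbb{R}$ is convex, and that $\phi=f+r$ is bounded below; $\min\phi$ denotes its infimum. Let $\bar\rho>\rho$ and let $(\alpha_t)_{t\ge0}$ be stepsizes with $0<\alpha_t<\min\{\frac1{\bar\rho},\frac{\bar\rho-\rho}{2}\}$. For $u>0$ let $f_u(x)=\mathbb{E}_{z\sim\mathcal N(0,I_n)}[f(x+uz)]$; put $u_{1,t}=\alpha_t^2$, $u_{2,t}=\alpha_t^3$, $\phi^{u,t}=f_{u_{1,t}}+r$, and for a function $h$ on $\mathbb{R}^n$ write $h_{1/\lambda}(x)=\min_y\{h(y)+\frac\lambda2\|y-x\|^2\}$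 for its Moreau envelope. Starting from a given $x_0\in\mathbb{R}^n$, the proximal stochastic derivative-free method draws, at each iteration $t=0,1,\dots$, independent samples $\xi_t\sim P$ and $Z_{1,t},Z_{2,t}\sim\mathcal N(0,I_n)$ (independent also of those of the other iterations), forms $$g_t=\frac{F(x_t+u_{1,t}Z_{1,t}+u_{2,t}Z_{2,t};\xi_t)-F(x_t+u_{1,t}Z_{1,t};\xi_t)}{u_{2,t}}\,Z_{2,t},$$ and sets $x_{t+1}=\operatorname{argmin}_y\{r(y)+\frac1{2\alpha_t}\|y-(x_t-\alpha_tg_t)\|^2\}$. After the iterations $t=0,\dots,T$ it draws $t^*\in\{0,\dots,T\}$, independently of the samples, with $\mathbb{P}(t^*=t)=\alpha_t/\sum_{i=0}^T\alpha_i$, and returns $x_{t^*}$. Theorem. There are finite constants $\bar B,B>0$, depending only on $n,L_0,\rho,\bar\rho$ (in particular not on $t$, $T$, the stepsizes or $x_0$), such that $f_u(x)\le f(x)+u\bar B\sqrt{n+2}$ for all $u>0$ and all $x$, the envelopes $\phi^{u,t}_{1/\bar\rho}$ are differentiable, all expectations below are finite, and, for every $t\ge0$, $$\mathbb{E}[\phi_{1/\bar\rho}(x_{t+1})]\le\mathbb{E}[\phi_{1/\bar\rho}(x_t)]+\alpha_t^2\bar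 B\sqrt{n+2}+\frac{B\bar\rho}{2}\alpha_t^2-\frac{\alpha_t(\bar\rho-\rho)}{2\bar\rho}\,\mathbb{E}\big[\|\nabla\phi^{u,t}_{1/\bar\rho}(x_t)\|^2\big],$$ and, for every $T\ge0$, $$\mathbb{E}\big[\|\nabla\phi^{u,t^*}_{1/\bar\rho}(x_{t^*})\|^2\big]=\frac{1}{\sum_{t=0}^T\alpha_t}\sum_{t=0}^T\alpha_t\,\mathbb{E}\big[\|\nabla\phi^{u,t}_{1/\bar\rho}(x_t)\|^2\big]\le\frac{2\bar\rho}{\bar\rho-\rho}\cdot\frac{\phi^{u,0}(x_0)-\min\phi+\big(\bar B\sqrt{n+2}+\frac{B\bar\rho}{2}\big)\sum_{t=0}^T\alpha_t^2}{\sum_{t=0}^T\alpha_t}.$$ -/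

import Mathlib

open MeasureTheory ProbabilityTheory

universe u v

noncomputable section

namespace ZeroOrder

/-- A minimizer of `h` over the whole space (an arbitrary point if `h` has no minimizer). -/
def argmin {n : ℕ} (h : EuclideanSpace ℝ (Fin n) → ℝ) : EuclideanSpace ℝ (Fin n) :=
  Classical.epsilon fun y => ∀ z, h y ≤ h z

/-- The proximal map `prox_{a r}(x) = argmin_y { r(y) + (1 / (2a)) ‖y - x‖² }`. -/
def prox {n : ℕ} (a : ℝ) (r : EuclideanSpace ℝ (Fin n) → ℝ) (x : EuclideanSpace ℝ (Fin n)) :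
    EuclideanSpace ℝ (Fin n) :=
  argmin fun y => r y + 1 / (2 * a) * ‖y - x‖ ^ 2

/-- The Moreau envelope `h_{1/lam}(x) = min_y { h(y) + (lam / 2) ‖y - x‖² }`. -/
def moreau {n : ℕ} (h : EuclideanSpace ℝ (Fin n) → ℝ) (lam : ℝ) (x : EuclideanSpace ℝ (Fin n)) :
    ℝ :=
  ⨅ y, (h y + lam / 2 * ‖y - x‖ ^ 2)

/-- The expected function `f(x) = E_ξ[F(x; ξ)]`, `ξ ∼ P`. -/
def expected {n : ℕ} {Ξ : Type u} [MeasurableSpace Ξ] (P : Measure Ξ)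
    (F : EuclideanSpace ℝ (Fin n) → Ξ → ℝ) (x : EuclideanSpace ℝ (Fin n)) : ℝ :=
  ∫ s, F x s ∂P

/-- Gaussian smoothing `f_w(x) = E[f(x + w z)]`, `z ∼ N(0, I_n)`, with smoothing radius `w`. -/
def smooth {n : ℕ} (f : EuclideanSpace ℝ (Fin n) → ℝ) (w : ℝ) (x : EuclideanSpace ℝ (Fin n)) : ℝ :=
  ∫ z, f (x + w • z) ∂(stdGaussian (EuclideanSpace ℝ (Fin n)))

/-- The two-point estimate
`G(x, u₁, u₂, z₁, z₂, s) = ((F(x + u₁ z₁ + u₂ z₂; s) - F(x + u₁ z₁; s)) / u₂) z₂`. -/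
def twoPoint {n : ℕ} {Ξ : Type u} (F : EuclideanSpace ℝ (Fin n) → Ξ → ℝ)
    (x : EuclideanSpace ℝ (Fin n)) (u₁ u₂ : ℝ) (z₁ z₂ : EuclideanSpace ℝ (Fin n)) (s : Ξ) :
    EuclideanSpace ℝ (Fin n) :=
  ((F (x + u₁ • z₁ + u₂ • z₂) s - F (x + u₁ • z₁) s) / u₂) • z₂

/-- The iterates of the proximal stochastic derivative-free method with stepsizes `α`, started at
`x₀`, as a function of the samples `s t`, `z₁ t`, `z₂ t` drawn at the iterations `t = 0, 1, …`;
the smoothing radii at iteration `t` are `(α t)²` and `(α t)³`. -/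
def iterate {n : ℕ} {Ξ : Type u} (F : EuclideanSpace ℝ (Fin n) → Ξ → ℝ)
    (r : EuclideanSpace ℝ (Fin n) → ℝ) (α : ℕ → ℝ) (x₀ : EuclideanSpace ℝ (Fin n))
    (s : ℕ → Ξ) (z₁ z₂ : ℕ → EuclideanSpace ℝ (Fin n)) : ℕ → EuclideanSpace ℝ (Fin n)
  | 0 => x₀
  | t + 1 =>
    prox (α t) r (iterate F r α x₀ s z₁ z₂ t - α t •
      twoPoint F (iterate F r α x₀ s z₁ z₂ t) (α t ^ 2) (α t ^ 3) (z₁ t) (z₂ t) (s t))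

/-- The random samples of the method: the triples `(ξ_t, Z_{1,t}, Z_{2,t})`, `t = 0, 1, …`, are
independent, and each has law `P ⊗ N(0, I_n) ⊗ N(0, I_n)`. -/
structure IsSampling {n : ℕ} {Ξ : Type u} {Ω : Type v} [MeasurableSpace Ξ] [MeasurableSpace Ω]
    (μ : Measure Ω) (P : Measure Ξ) (ξ : ℕ → Ω → Ξ) (Z₁ Z₂ : ℕ → Ω → EuclideanSpace ℝ (Fin n)) :
    Prop where
  measurable : ∀ t, Measurable fun ω => (ξ t ω, Z₁ t ω, Z₂ t ω)
  law : ∀ t, μ.map (fun ω => (ξ t ω, Z₁ t ω, Z₂ t ω)) =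
    P.prod ((stdGaussian (EuclideanSpace ℝ (Fin n))).prod (stdGaussian (EuclideanSpace ℝ (Fin n))))
  indep : iIndepFun (fun t ω => (ξ t ω, Z₁ t ω, Z₂ t ω)) μ

/-- The random output index `t*`: it takes the value `t ∈ {0, …, T}` with probability
`α_t / ∑_{i ≤ T} α_i` and is independent of the samples of the method. -/
structure IsOutputIndex {n : ℕ} {Ξ : Type u} {Ω : Type v} [MeasurableSpace Ξ] [MeasurableSpace Ω]
    (μ : Measure Ω) (ξ : ℕ → Ω → Ξ) (Z₁ Z₂ : ℕ → Ω → EuclideanSpace ℝ (Fin n))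
    (α : ℕ → ℝ) (T : ℕ) (τ : Ω → ℕ) : Prop where
  measurable : Measurable τ
  law : ∀ t ∈ Finset.range (T + 1),
    μ {ω | τ ω = t} = ENNReal.ofReal (α t / ∑ i ∈ Finset.range (T + 1), α i)
  indep : IndepFun τ (fun ω t => (ξ t ω, Z₁ t ω, Z₂ t ω)) μ

end ZeroOrder

end

namespace ZeroOrder

open Filter Topology

local notation "𝔼" n => EuclideanSpace ℝ (Fin n)

variable {n : ℕ}

/-- Weak convexity with modulus `σ`, expressed through the defining inequality on segments. -/
def IsWeaklyConvex (w : (𝔼 n) → ℝ) (σ : ℝ) : Prop :=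
  ∀ x y : 𝔼 n, ∀ t : ℝ, 0 ≤ t → t ≤ 1 →
    w ((1 - t) • x + t • y) ≤ (1 - t) * w x + t * w y + σ / 2 * (t * (1 - t)) * ‖x - y‖ ^ 2

lemma norm_sq_segment (x y c : 𝔼 n) (t : ℝ) :
    ‖(1 - t) • x + t • y - c‖ ^ 2 =
      (1 - t) * ‖x - c‖ ^ 2 + t * ‖y - c‖ ^ 2 - t * (1 - t) * ‖x - y‖ ^ 2 := by
  have h1 : (1 - t) • x + t • y - c = (1 - t) • (x - c) + t • (y - c) := by module
  have h2 : x - y = (x - c) - (y - c) := by abel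
  rw [h1, h2]
  generalize x - c = a, y - c = b
  rw [norm_add_sq_real, norm_sub_sq_real, norm_smul, norm_smul, mul_pow, mul_pow,
    real_inner_smul_left, real_inner_smul_right, Real.norm_eq_abs, Real.norm_eq_abs, sq_abs,
    sq_abs]
  ring

lemma isWeaklyConvex_iff {w : (𝔼 n) → ℝ} {σ : ℝ} :
    IsWeaklyConvex w σ ↔ ConvexOn ℝ Set.univ (fun x => w x + σ / 2 * ‖x‖ ^ 2) := by
  have key (x y : 𝔼 n) (t : ℝ) := norm_sq_segment x y 0 t
  simp only [sub_zero] at key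
  constructor
  · intro h
    refine ⟨convex_univ, fun x _ y _ a b ha hb hab => ?_⟩
    obtain rfl : a = 1 - b := by linarith
    have := h x y b hb (by linarith)
    simp only [smul_eq_mul, key]
    linarith
  · intro h x y t h0 h1
    have := h.2 (Set.mem_univ x) (Set.mem_univ y) (by linarith : 0 ≤ 1 - t) h0 (by ring)
    simp only [smul_eq_mul, key] at this
    linarith

lemma IsWeaklyConvex.continuous {w : (𝔼 n) → ℝ} {σ : ℝ} (h : IsWeaklyConvex w σ) :
    Continuous w := by
  have h1 := (isWeaklyConvex_iff.1 h).continuousOn isOpen_univ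
  rw [continuousOn_univ] at h1
  have h2 : w = fun x => (w x + σ / 2 * ‖x‖ ^ 2) - σ / 2 * ‖x‖ ^ 2 := by
    ext x; ring
  rw [h2]
  exact h1.sub (by fun_prop)

lemma isWeaklyConvex_zero_iff {w : (𝔼 n) → ℝ} :
    IsWeaklyConvex w 0 ↔ ConvexOn ℝ Set.univ w := by
  rw [isWeaklyConvex_iff]
  simp

lemma IsWeaklyConvex.add {w₁ w₂ : (𝔼 n) → ℝ} {σ₁ σ₂ : ℝ} (h₁ : IsWeaklyConvex w₁ σ₁)
    (h₂ : IsWeaklyConvex w₂ σ₂) : IsWeaklyConvex (fun x => w₁ x + w₂ x) (σ₁ + σ₂) := by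
  intro x y t h0 h1
  have e1 := h₁ x y t h0 h1
  have e2 := h₂ x y t h0 h1
  simp only
  linarith

/-- `p` minimizes `w + (lam / 2) ‖· - x‖²`. -/
def IsProxPoint (w : (𝔼 n) → ℝ) (lam : ℝ) (x p : 𝔼 n) : Prop :=
  ∀ y, w p + lam / 2 * ‖p - x‖ ^ 2 ≤ w y + lam / 2 * ‖y - x‖ ^ 2

/-- Compare `p` with `(1 - t) p + t y`, divide by `t` and let `t → 0`: the penalized function has
convexity modulus `lam - σ`, hence grows quadratically away from its minimizer. -/
lemma IsProxPoint.growth {w : (𝔼 n) → ℝ} {σ lam : ℝ} {x p : 𝔼 n} (hw : IsWeaklyConvex w σ)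
    (hp : IsProxPoint w lam x p) (y : 𝔼 n) :
    w p + lam / 2 * ‖p - x‖ ^ 2 + (lam - σ) / 2 * ‖y - p‖ ^ 2 ≤ w y + lam / 2 * ‖y - x‖ ^ 2 := by
  have key : ∀ t : ℝ, t ∈ Set.Ioo (0 : ℝ) 1 →
      w p + lam / 2 * ‖p - x‖ ^ 2 + (1 - t) * ((lam - σ) / 2 * ‖y - p‖ ^ 2)
        ≤ w y + lam / 2 * ‖y - x‖ ^ 2 := by
    rintro t ⟨h0, h1⟩
    have e1 := hp ((1 - t) • p + t • y)
    have e2 := hw p y t h0.le h1.le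
    rw [norm_sq_segment] at e1
    rw [norm_sub_rev p y] at e1 e2
    refine le_of_mul_le_mul_left ?_ h0
    nlinarith
  have hlim : Tendsto (fun t : ℝ => w p + lam / 2 * ‖p - x‖ ^ 2 +
      (1 - t) * ((lam - σ) / 2 * ‖y - p‖ ^ 2)) (𝓝[>] 0)
      (𝓝 (w p + lam / 2 * ‖p - x‖ ^ 2 + (1 - 0) * ((lam - σ) / 2 * ‖y - p‖ ^ 2))) := by
    apply Tendsto.mono_left _ nhdsWithin_le_nhds
    apply Continuous.tendsto
    fun_prop
  rw [sub_zero, one_mul] at hlim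
  refine le_of_tendsto hlim ?_
  filter_upwards [Ioo_mem_nhdsGT (zero_lt_one' ℝ)] with t ht using key t ht

/-- The quadratic penalty beats a linear descent of `w`, so the sum is coercive. A linear term is
allowed because `r` alone need not be bounded below. -/
lemma exists_isProxPoint {w : (𝔼 n) → ℝ} (hw : Continuous w) {a b lam : ℝ} (hlam : 0 < lam)
    (hb : 0 ≤ b) (hlow : ∀ y, a - b * ‖y‖ ≤ w y) (x : 𝔼 n) : ∃ p, IsProxPoint w lam x p := by
  have hcont : Continuous fun y => w y + lam / 2 * ‖y - x‖ ^ 2 := by fun_prop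
  refine hcont.exists_forall_le ?_
  have h1 : Tendsto (fun y : 𝔼 n => ‖y - x‖) (cocompact _) atTop := by
    refine tendsto_atTop_mono (fun y => (sub_le_iff_le_add.2 ?_ : ‖y‖ - ‖x‖ ≤ ‖y - x‖))
      (tendsto_atTop_add_const_right _ _ (tendsto_norm_cocompact_atTop (E := 𝔼 n)))
    simpa using norm_add_le (y - x) x
  have h2 : Tendsto (fun s : ℝ => a - b * ‖x‖ + s * (lam / 2 * s - b)) atTop atTop := by
    refine tendsto_atTop_add_const_left _ _ (tendsto_id.atTop_mul_atTop₀ ?_)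
    exact tendsto_atTop_add_const_right _ _ (tendsto_id.const_mul_atTop (by positivity))
  refine tendsto_atTop_mono (fun y => ?_) (h2.comp h1)
  have h3 : ‖y‖ ≤ ‖y - x‖ + ‖x‖ := by simpa using norm_add_le (y - x) x
  have := hlow y
  have := mul_le_mul_of_nonneg_left h3 hb
  simp only [Function.comp_apply]
  nlinarith

lemma norm_sub_sq_cross (p q x y : 𝔼 n) :
    ‖q - x‖ ^ 2 + ‖p - y‖ ^ 2 - ‖p - x‖ ^ 2 - ‖q - y‖ ^ 2 = 2 * inner ℝ (x - y) (p - q) := by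
  simp only [norm_sub_sq_real, inner_sub_left, inner_sub_right, real_inner_comm]
  rw [real_inner_comm x p, real_inner_comm x q]
  ring

/-- In the sum of the two growth inequalities, each tested at the other point, the values of `w`
cancel and the quadratics leave an inner product, to which Cauchy–Schwarz applies. -/
lemma IsProxPoint.norm_sub_le {w : (𝔼 n) → ℝ} {σ lam : ℝ} {x y p q : 𝔼 n}
    (hw : IsWeaklyConvex w σ) (hlam : 0 ≤ lam) (hp : IsProxPoint w lam x p)
    (hq : IsProxPoint w lam y q) :
    (lam - σ) * ‖p - q‖ ≤ lam * ‖x - y‖ := by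
  have h1 := hp.growth hw q
  have h2 := hq.growth hw p
  have h3 := norm_sub_sq_cross p q x y
  have h4 := real_inner_le_norm (x - y) (p - q)
  rw [norm_sub_rev q p] at h1
  by_cases h0 : ‖p - q‖ = 0
  · rw [h0]; simp; positivity
  have hpos : 0 < ‖p - q‖ := lt_of_le_of_ne (norm_nonneg _) (Ne.symm h0)
  refine le_of_mul_le_mul_right ?_ hpos
  have := mul_le_mul_of_nonneg_left h4 hlam
  nlinarith

lemma IsProxPoint.moreau_eq {w : (𝔼 n) → ℝ} {lam : ℝ} {x p : 𝔼 n} (hp : IsProxPoint w lam x p) :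
    moreau w lam x = w p + lam / 2 * ‖p - x‖ ^ 2 :=
  le_antisymm (ciInf_le (f := fun y => w y + lam / 2 * ‖y - x‖ ^ 2)
    ⟨_, by rintro _ ⟨y, rfl⟩; exact hp y⟩ p) (le_ciInf hp)

/-- Using the proximal point of `a` as a competitor at `b` gives a quadratic upper bound. With `a`
and `b` exchanged it becomes a lower bound with the gradient taken at `y`; Lipschitz continuity of
the proximal map moves that gradient back to `x`. -/
lemma hasGradientAt_moreau {w : (𝔼 n) → ℝ} {σ lam : ℝ} (hw : IsWeaklyConvex w σ)
    (hlam : 0 ≤ lam) (hσ : σ < lam) {p : (𝔼 n) → 𝔼 n} (hp : ∀ x, IsProxPoint w lam x (p x))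
    (x : 𝔼 n) : HasGradientAt (moreau w lam) (lam • (x - p x)) x := by
  rw [hasGradientAt_iff_hasFDerivAt]
  set K : ℝ := lam * (1 + lam / (lam - σ)) with hK
  have hm : 0 < lam - σ := sub_pos.2 hσ
  have upper (a b : 𝔼 n) : moreau w lam b - moreau w lam a
      ≤ lam * inner ℝ (a - p a) (b - a) + lam / 2 * ‖b - a‖ ^ 2 := by
    have h1 := (hp b (p a))
    rw [(hp a).moreau_eq, (hp b).moreau_eq]
    have h2 : ‖p a - b‖ ^ 2 = ‖p a - a‖ ^ 2 + 2 * inner ℝ (a - p a) (b - a) + ‖b - a‖ ^ 2 := by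
      have : p a - b = (p a - a) - (b - a) := by abel
      rw [this, norm_sub_sq_real, ← neg_sub a (p a), inner_neg_left, norm_neg]
      ring
    rw [h2] at h1
    linarith
  have hbound (y : 𝔼 n) :
      ‖moreau w lam y - moreau w lam x - inner ℝ (lam • (x - p x)) (y - x)‖
        ≤ K * ‖y - x‖ ^ 2 := by
    have h1 := upper x y
    have h2 := upper y x
    rw [norm_sub_rev x y] at h2
    have h3 : inner ℝ (y - p y) (x - y)
        = - inner ℝ (x - p x) (y - x) - ‖y - x‖ ^ 2 + inner ℝ (p y - p x) (y - x) := by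
      rw [← real_inner_self_eq_norm_sq, ← neg_sub y x, inner_neg_right]
      simp only [inner_sub_left]
      ring
    have h4 := real_inner_le_norm (p y - p x) (y - x)
    have h5 : ‖p y - p x‖ ≤ lam / (lam - σ) * ‖y - x‖ := by
      rw [div_mul_eq_mul_div, le_div_iff₀ hm, mul_comm]
      exact (hp y).norm_sub_le hw hlam (hp x)
    have h6 : inner ℝ (p y - p x) (y - x) ≤ lam / (lam - σ) * ‖y - x‖ ^ 2 := by
      nlinarith [mul_le_mul_of_nonneg_right h5 (norm_nonneg (y - x))]
    have h7 := mul_le_mul_of_nonneg_left h6 hlam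
    have h8 : 0 ≤ lam * (lam / (lam - σ)) * ‖y - x‖ ^ 2 := by positivity
    have h9 : 0 ≤ lam * ‖y - x‖ ^ 2 := by positivity
    rw [h3] at h2
    rw [real_inner_smul_left, Real.norm_eq_abs, abs_le, hK]
    constructor <;> nlinarith
  refine HasFDerivAt.of_isLittleO ?_
  simp only [InnerProductSpace.toDual_apply_apply]
  have h1 : (fun y : 𝔼 n => moreau w lam y - moreau w lam x -
      inner ℝ (lam • (x - p x)) (y - x)) =O[𝓝 x] fun y => ‖y - x‖ ^ 2 := by
    refine Asymptotics.IsBigO.of_bound K (Eventually.of_forall fun y => ?_)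
    simpa using hbound y
  refine h1.trans_isLittleO ?_
  have h2 : Tendsto (fun y : 𝔼 n => y - x) (𝓝 x) (𝓝 0) := by
    simpa using (continuous_id.sub continuous_const).tendsto x (f := fun y : 𝔼 n => y - x)
  exact (Asymptotics.isLittleO_norm_pow_id (n := 2) (by norm_num)).comp_tendsto h2

lemma isProxPoint_prox {r : (𝔼 n) → ℝ} {a : ℝ} {x : 𝔼 n} (h : ∃ p, IsProxPoint r (1 / a) x p) :
    IsProxPoint r (1 / a) x (prox a r x) := by
  have e : (1 : ℝ) / (2 * a) = 1 / a / 2 := by rw [div_div, mul_comm]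
  have := Classical.epsilon_spec (p := fun y => ∀ z,
    r y + 1 / (2 * a) * ‖y - x‖ ^ 2 ≤ r z + 1 / (2 * a) * ‖z - x‖ ^ 2) (by simpa only [e, IsProxPoint] using h)
  simp only [IsProxPoint, ← e]
  exact this

/-! ### Gaussian moments and reflections. -/

/-- The `k`-th moment of the norm of a standard Gaussian vector in `ℝⁿ`. -/
noncomputable def gaussianMoment (n k : ℕ) : ℝ := ∫ z, ‖z‖ ^ k ∂(stdGaussian (𝔼 n))

lemma gaussianMoment_nonneg (n k : ℕ) : 0 ≤ gaussianMoment n k :=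
  integral_nonneg fun _ => by positivity

lemma integrable_norm_pow_stdGaussian (k : ℕ) :
    Integrable (fun z => ‖z‖ ^ k) (stdGaussian (𝔼 n)) := by
  have h := (IsGaussian.memLp_id (stdGaussian (𝔼 n)) k (by simp)).integrable_norm_pow'
  exact h

lemma integral_inner_sq_stdGaussian (d : 𝔼 n) :
    ∫ z, (inner ℝ z d) ^ 2 ∂(stdGaussian (𝔼 n)) = ‖d‖ ^ 2 := by
  have h := variance_dual_stdGaussian (innerSL ℝ d)
  rw [variance_of_integral_eq_zero (by fun_prop) (integral_strongDual_stdGaussian _),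
    innerSL_apply_norm] at h
  rw [← h]
  simp [real_inner_comm]

/-- Reflection in the hyperplane orthogonal to `d`. -/
noncomputable def reflect (d : 𝔼 n) : (𝔼 n) ≃ₗᵢ[ℝ] (𝔼 n) := (Submodule.span ℝ {d})ᗮ.reflection

lemma reflect_apply (d z : 𝔼 n) :
    reflect d z = z - (2 * (inner ℝ z d / ‖d‖ ^ 2)) • d := by
  rw [reflect, Submodule.reflection_orthogonal_apply, Submodule.reflection_singleton_apply,
    real_inner_comm]
  simp only [RCLike.ofReal_real_eq_id, id]
  module

lemma reflect_reflect (d z : 𝔼 n) : reflect d (reflect d z) = z :=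
  Submodule.reflection_reflection _ z

lemma inner_reflect {d : 𝔼 n} (z : 𝔼 n) : inner ℝ (reflect d z) d = - inner ℝ z d := by
  by_cases hd : d = 0
  · simp [hd]
  have : ‖d‖ ≠ 0 := norm_ne_zero_iff.2 hd
  rw [reflect_apply, inner_sub_left, real_inner_smul_left, real_inner_self_eq_norm_sq]
  field_simp
  ring

lemma integral_comp_reflect (d : 𝔼 n) (g : (𝔼 n) → ℝ) :
    ∫ z, g (reflect d z) ∂(stdGaussian (𝔼 n)) = ∫ z, g z ∂(stdGaussian (𝔼 n)) := by
  have h := stdGaussian_map (reflect d)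
  conv_rhs => rw [← h]
  exact ((reflect d).toHomeomorph.toMeasurableEquiv.measurableEmbedding.integral_map g).symm

lemma integrable_comp_reflect (d : 𝔼 n) {g : (𝔼 n) → ℝ} (hg : Integrable g (stdGaussian (𝔼 n))) :
    Integrable (fun z => g (reflect d z)) (stdGaussian (𝔼 n)) := by
  rw [← stdGaussian_map (reflect d)] at hg
  exact hg.comp_measurable (reflect d).continuous.measurable

/-! ### The averaged difference quotient as an approximate subgradient. -/

lemma reflected_difference_le_of_inner_nonneg {f : (𝔼 n) → ℝ} {L ρ w : ℝ} (hL : 0 ≤ L)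
    (hρ : 0 ≤ ρ) (hw : 0 < w) (hconv : IsWeaklyConvex f ρ)
    (hlip : ∀ x y, |f x - f y| ≤ L * ‖x - y‖) (x z d : 𝔼 n) (hp : 0 ≤ inner ℝ z d) :
    (f (x + w • z) - f (x + w • reflect d z)) * inner ℝ z d / (2 * w) ≤
      (inner ℝ z d / ‖d‖) ^ 2 * (f (x + d) - f x + ρ / 2 * ‖d‖ ^ 2)
        + w * ‖z‖ ^ 3 * (2 * L + ρ * ‖d‖) := by
  have hcs := real_inner_le_norm z d
  have hrefl := reflect_apply d z
  generalize hpp : inner ℝ z d = p at *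
  rcases hp.eq_or_lt with hp0 | hp0
  · rw [← hp0]; simp; positivity
  have hD : 0 < ‖d‖ := by
    by_contra! h
    have : ‖d‖ = 0 := le_antisymm h (norm_nonneg _)
    rw [this] at hcs
    linarith [mul_zero ‖z‖]
  set y := x + w • reflect d z with hy
  set c : ℝ := 2 * w * p / ‖d‖ ^ 2 with hc
  have hcpos : 0 < c := by positivity
  have hxz : x + w • z = y + c • d := by
    rw [hy, hrefl, hc]; module
  clear_value y c
  -- The points `y`, `y + c d = x + w z` and `y + (c + 1) d = x + w z + d` are collinear: the slope
  -- between the first two is controlled by the increment over the following step `d`.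
  have h1 := hconv y (y + (c + 1) • d) (c / (c + 1)) (by positivity)
    (by rw [div_le_one (by positivity)]; linarith)
  have h2 : (1 - c / (c + 1)) • y + (c / (c + 1)) • (y + (c + 1) • d) = y + c • d := by
    have : c / (c + 1) * (c + 1) = c := by field_simp
    rw [smul_add, smul_smul, this]; module
  have h3 : ‖y - (y + (c + 1) • d)‖ ^ 2 = (c + 1) ^ 2 * ‖d‖ ^ 2 := by
    rw [sub_add_cancel_left, norm_neg, norm_smul, mul_pow, Real.norm_eq_abs, sq_abs]
  rw [h2, h3] at h1
  have h4 : y + (c + 1) • d = x + w • z + d := by rw [hxz]; module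
  rw [h4, ← hxz] at h1
  have h5 : (c + 1) * f (x + w • z) ≤ f y + c * f (x + w • z + d)
      + ρ / 2 * c * (c + 1) * ‖d‖ ^ 2 := by
    have := mul_le_mul_of_nonneg_left h1 (by positivity : 0 ≤ c + 1)
    refine this.trans (le_of_eq ?_)
    field_simp
    ring
  -- Lipschitz continuity moves the base point of the increment from `x + w z` to `x`, which no
  -- longer depends on `z`.
  have h6 : f (x + w • z + d) - f (x + w • z) ≤ f (x + d) - f x + 2 * L * (w * ‖z‖) := by
    have e1 := (abs_le.1 (hlip (x + w • z + d) (x + d))).2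
    have e2 := (abs_le.1 (hlip (x + w • z) x)).1
    have e3 : x + w • z + d - (x + d) = w • z := by abel
    have e4 : x + w • z - x = w • z := by abel
    rw [e3, norm_smul, Real.norm_of_nonneg hw.le] at e1
    rw [e4, norm_smul, Real.norm_of_nonneg hw.le] at e2
    linarith
  have h7 : f (x + w • z) - f y ≤ c * (f (x + d) - f x + ρ / 2 * ‖d‖ ^ 2)
      + c * w * ‖z‖ * (2 * L + ρ * ‖d‖) := by
    have e1 := mul_le_mul_of_nonneg_left h6 hcpos.le
    have e2 : c * ‖d‖ ^ 2 = 2 * w * p := by rw [hc]; field_simp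
    have e3 : ρ / 2 * c * (c + 1) * ‖d‖ ^ 2 =
        ρ / 2 * c * ‖d‖ ^ 2 + ρ * c * w * p := by
      linear_combination (ρ / 2 * c) * e2
    have e4 : ρ * c * w * p ≤ ρ * c * w * (‖z‖ * ‖d‖) :=
      mul_le_mul_of_nonneg_left hcs (by positivity)
    linarith
  have h8 := mul_le_mul_of_nonneg_right h7 (by positivity : 0 ≤ p / (2 * w))
  have h9 : c * (p / (2 * w)) = (p / ‖d‖) ^ 2 := by rw [hc]; field_simp
  have h10 : (p / ‖d‖) ^ 2 ≤ ‖z‖ ^ 2 := by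
    apply pow_le_pow_left₀ (by positivity)
    rwa [div_le_iff₀ hD]
  have h11 : (p / ‖d‖) ^ 2 * (w * ‖z‖ * (2 * L + ρ * ‖d‖))
      ≤ ‖z‖ ^ 2 * (w * ‖z‖ * (2 * L + ρ * ‖d‖)) :=
    mul_le_mul_of_nonneg_right h10 (by positivity)
  calc (f (x + w • z) - f y) * p / (2 * w) = (f (x + w • z) - f y) * (p / (2 * w)) := by ring
    _ ≤ _ := h8
    _ = (c * (p / (2 * w))) * (f (x + d) - f x + ρ / 2 * ‖d‖ ^ 2)
        + (c * (p / (2 * w))) * (w * ‖z‖ * (2 * L + ρ * ‖d‖)) := by ring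
    _ ≤ _ := by rw [h9]; linarith

/-- Both sides are unchanged when `z` is replaced by its reflection, so the sign of `⟨z, d⟩` may be
chosen. -/
lemma reflected_difference_le {f : (𝔼 n) → ℝ} {L ρ w : ℝ} (hL : 0 ≤ L)
    (hρ : 0 ≤ ρ) (hw : 0 < w) (hconv : IsWeaklyConvex f ρ)
    (hlip : ∀ x y, |f x - f y| ≤ L * ‖x - y‖) (x z d : 𝔼 n) :
    (f (x + w • z) - f (x + w • reflect d z)) * inner ℝ z d / (2 * w) ≤
      (inner ℝ z d / ‖d‖) ^ 2 * (f (x + d) - f x + ρ / 2 * ‖d‖ ^ 2)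
        + w * ‖z‖ ^ 3 * (2 * L + ρ * ‖d‖) := by
  rcases le_total 0 (inner ℝ z d) with h | h
  · exact reflected_difference_le_of_inner_nonneg hL hρ hw hconv hlip x z d h
  · have h' : 0 ≤ inner ℝ (reflect d z) d := by rw [inner_reflect]; linarith
    have := reflected_difference_le_of_inner_nonneg hL hρ hw hconv hlip x (reflect d z) d h'
    rw [reflect_reflect, inner_reflect, LinearIsometryEquiv.norm_map, neg_div, neg_sq] at this
    refine (le_of_eq ?_).trans this
    ring

lemma integrable_difference_mul_inner {f : (𝔼 n) → ℝ} {L : ℝ} (w : ℝ) (hcont : Continuous f)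
    (hlip : ∀ x y, |f x - f y| ≤ L * ‖x - y‖) (x d : 𝔼 n) :
    Integrable (fun z => (f (x + w • z) - f x) / w * inner ℝ z d) (stdGaussian (𝔼 n)) := by
  -- The factor `|w| / |w|` also covers `w = 0`, where the difference quotient is `0` by convention.
  refine Integrable.mono' ((integrable_norm_pow_stdGaussian (n := n) 2).const_mul
    (L * (|w| / |w|) * ‖d‖))
    (Continuous.aestronglyMeasurable (by fun_prop)) (Filter.Eventually.of_forall fun z => ?_)
  have h1 := hlip (x + w • z) x
  rw [add_sub_cancel_left, norm_smul, Real.norm_eq_abs] at h1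
  rw [Real.norm_eq_abs, abs_mul, abs_div]
  have h2 := abs_real_inner_le_norm z d
  calc |f (x + w • z) - f x| / |w| * |inner ℝ z d|
      ≤ L * (|w| * ‖z‖) / |w| * (‖z‖ * ‖d‖) :=
          mul_le_mul (div_le_div_of_nonneg_right h1 (abs_nonneg _)) h2 (abs_nonneg _)
            (div_nonneg ((abs_nonneg _).trans h1) (abs_nonneg _))
    _ = _ := by ring

/-- Averaging the integrand with its reflection cancels `f x`; the weight `(⟨z, d⟩ / ‖d‖)²` in the
pointwise bound has mean one. -/
lemma integral_difference_mul_inner_le {f : (𝔼 n) → ℝ} {L ρ w : ℝ} (hL : 0 ≤ L)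
    (hρ : 0 ≤ ρ) (hw : 0 < w) (hconv : IsWeaklyConvex f ρ)
    (hlip : ∀ x y, |f x - f y| ≤ L * ‖x - y‖) (x d : 𝔼 n) :
    ∫ z, (f (x + w • z) - f x) / w * inner ℝ z d ∂(stdGaussian (𝔼 n)) ≤
      f (x + d) - f x + ρ / 2 * ‖d‖ ^ 2 + w * gaussianMoment n 3 * (2 * L + ρ * ‖d‖) := by
  have hM := gaussianMoment_nonneg n 3
  by_cases hd : d = 0
  · simp [hd]; positivity
  have hd' : ‖d‖ ≠ 0 := norm_ne_zero_iff.2 hd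
  set g : (𝔼 n) → ℝ := fun z => (f (x + w • z) - f x) / w * inner ℝ z d with hg
  have hgi : Integrable g (stdGaussian (𝔼 n)) :=
    integrable_difference_mul_inner w hconv.continuous hlip x d
  have hgr := integrable_comp_reflect d hgi
  have h1 : ∫ z, g z ∂(stdGaussian (𝔼 n)) = ∫ z, (g z + g (reflect d z)) / 2 ∂(stdGaussian (𝔼 n)) := by
    rw [integral_div, integral_add hgi hgr, integral_comp_reflect]
    ring
  have hi1 : Integrable (fun z => (inner ℝ z d / ‖d‖) ^ 2) (stdGaussian (𝔼 n)) := by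
    refine (integrable_norm_pow_stdGaussian (n := n) 2).mono'
      (Continuous.aestronglyMeasurable (by fun_prop)) (Filter.Eventually.of_forall fun z => ?_)
    rw [norm_pow, norm_div, norm_norm]
    gcongr
    rw [div_le_iff₀ (by positivity)]
    exact abs_real_inner_le_norm z d
  have hi2 := integrable_norm_pow_stdGaussian (n := n) 3
  rw [h1]
  calc ∫ z, (g z + g (reflect d z)) / 2 ∂(stdGaussian (𝔼 n))
      ≤ ∫ z, ((inner ℝ z d / ‖d‖) ^ 2 * (f (x + d) - f x + ρ / 2 * ‖d‖ ^ 2)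
        + w * ‖z‖ ^ 3 * (2 * L + ρ * ‖d‖)) ∂(stdGaussian (𝔼 n)) := by
        refine integral_mono ((hgi.add hgr).div_const 2)
          ((hi1.mul_const _).add ((hi2.const_mul w).mul_const _)) fun z => ?_
        refine le_trans (le_of_eq ?_) (reflected_difference_le hL hρ hw hconv hlip x z d)
        simp only [hg, inner_reflect]
        field_simp
        ring
    _ = _ := by
        rw [integral_add (hi1.mul_const _) ((hi2.const_mul w).mul_const _), integral_mul_const,
          integral_mul_const, integral_const_mul]
        simp_rw [div_pow]
        rw [integral_div, integral_inner_sq_stdGaussian, div_self (by positivity), gaussianMoment]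
        ring

/-! ### Gaussian smoothing of a Lipschitz weakly convex function. -/

lemma integrable_smooth {f : (𝔼 n) → ℝ} {L : ℝ} (hcont : Continuous f)
    (hlip : ∀ x y, |f x - f y| ≤ L * ‖x - y‖) (w : ℝ) (x : 𝔼 n) :
    Integrable (fun z => f (x + w • z)) (stdGaussian (𝔼 n)) := by
  have hi := integrable_norm_pow_stdGaussian (n := n) 1
  refine ((integrable_const |f x|).add (hi.const_mul (L * |w|))).mono'
    (Continuous.aestronglyMeasurable (by fun_prop)) (Filter.Eventually.of_forall fun z => ?_)
  have h1 := hlip (x + w • z) x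
  rw [add_sub_cancel_left, norm_smul, Real.norm_eq_abs] at h1
  have h2 := abs_sub_abs_le_abs_sub (f (x + w • z)) (f x)
  simp only [Pi.add_apply, pow_one, Real.norm_eq_abs]
  linarith

lemma abs_smooth_sub_le {f : (𝔼 n) → ℝ} {L : ℝ} (hcont : Continuous f)
    (hlip : ∀ x y, |f x - f y| ≤ L * ‖x - y‖) {w : ℝ} (hw : 0 ≤ w) (x : 𝔼 n) :
    |smooth f w x - f x| ≤ w * (L * gaussianMoment n 1) := by
  have hi := integrable_norm_pow_stdGaussian (n := n) 1
  have hs := integrable_smooth hcont hlip w x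
  have h1 : smooth f w x - f x = ∫ z, (f (x + w • z) - f x) ∂(stdGaussian (𝔼 n)) := by
    rw [integral_sub hs (integrable_const _)]
    simp [smooth]
  rw [h1, ← Real.norm_eq_abs, gaussianMoment, ← integral_const_mul, ← integral_const_mul]
  refine norm_integral_le_of_norm_le ((hi.const_mul _).const_mul _)
    (Filter.Eventually.of_forall fun z => ?_)
  have h1 := hlip (x + w • z) x
  rw [add_sub_cancel_left, norm_smul, Real.norm_of_nonneg hw] at h1
  rw [Real.norm_eq_abs, pow_one]
  linarith

lemma abs_smooth_sub_smooth_le {f : (𝔼 n) → ℝ} {L : ℝ} (hcont : Continuous f)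
    (hlip : ∀ x y, |f x - f y| ≤ L * ‖x - y‖) (w : ℝ) (x y : 𝔼 n) :
    |smooth f w x - smooth f w y| ≤ L * ‖x - y‖ := by
  rw [smooth, smooth, ← integral_sub (integrable_smooth hcont hlip w x)
    (integrable_smooth hcont hlip w y), ← Real.norm_eq_abs]
  refine (norm_integral_le_of_norm_le_const (C := L * ‖x - y‖)
    (Filter.Eventually.of_forall fun z => ?_)).trans (by simp)
  have := hlip (x + w • z) (y + w • z)
  rwa [add_sub_add_right_eq_sub] at this

lemma IsWeaklyConvex.smooth {f : (𝔼 n) → ℝ} {L ρ : ℝ} (hf : IsWeaklyConvex f ρ)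
    (hlip : ∀ x y, |f x - f y| ≤ L * ‖x - y‖) (w : ℝ) :
    IsWeaklyConvex (ZeroOrder.smooth f w) ρ := by
  intro x y t h0 h1
  have hi (x : 𝔼 n) := integrable_smooth hf.continuous hlip w x
  have ha : Integrable (fun z => (1 - t) * f (x + w • z) + t * f (y + w • z)) (stdGaussian (𝔼 n)) :=
    ((hi x).const_mul _).add ((hi y).const_mul _)
  have hc : Integrable (fun _ : 𝔼 n => ρ / 2 * (t * (1 - t)) * ‖x - y‖ ^ 2)
    (stdGaussian (𝔼 n)) := integrable_const _
  have h2 : ∫ z, ((1 - t) * f (x + w • z) + t * f (y + w • z)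
      + ρ / 2 * (t * (1 - t)) * ‖x - y‖ ^ 2) ∂(stdGaussian (𝔼 n)) =
      (1 - t) * ZeroOrder.smooth f w x + t * ZeroOrder.smooth f w y
        + ρ / 2 * (t * (1 - t)) * ‖x - y‖ ^ 2 := by
    rw [integral_add ha hc,
      integral_add ((hi x).const_mul _) ((hi y).const_mul _), integral_const_mul,
      integral_const_mul]
    simp [ZeroOrder.smooth]
  rw [← h2]
  refine integral_mono (hi _) (ha.add hc) fun z => ?_
  have := hf (x + w • z) (y + w • z) t h0 h1
  rw [add_sub_add_right_eq_sub] at this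
  refine (le_of_eq ?_).trans this
  simp only
  congr 1
  module

/-! ### Deterministic analysis of one proximal step. -/

/-- The gap between the estimated and the actual linear model of a weakly convex function `h`
along `d`, reduced by the error terms that a two-point estimate `g` of its slope admits. -/
noncomputable def modelGap (h : (𝔼 n) → ℝ) (ρ κ L : ℝ) (x d g : 𝔼 n) : ℝ :=
  h x - h (x + d) + inner ℝ g d - ρ / 2 * ‖d‖ ^ 2 - κ * (2 * L + ρ * ‖d‖)

/-- Test the growth at `xhat` at the new iterate, and the growth at the new iterate at `xhat`; the
values of `r` cancel in the sum. Replacing `xnext` by `x` in `h` and in the linear term costs `(L +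
‖g‖)‖xnext - x‖`, to be paid by the last, negative quadratic. -/
lemma prox_step_basic {h r : (𝔼 n) → ℝ} {L ρ ρbar a : ℝ} (hh : IsWeaklyConvex h ρ)
    (hlip : ∀ x y, |h x - h y| ≤ L * ‖x - y‖) (hr : IsWeaklyConvex r 0) (ha : 0 < a)
    {x xhat xnext g : 𝔼 n} (hxhat : IsProxPoint (fun y => h y + r y) ρbar x xhat)
    (hxnext : IsProxPoint r (1 / a) (x - a • g) xnext) :
    (1 / (2 * a) + (ρbar - ρ) / 2) * ‖xnext - xhat‖ ^ 2 ≤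
      (1 / (2 * a) - ρbar / 2) * ‖xhat - x‖ ^ 2 + (h x - h xhat + inner ℝ g (xhat - x))
        + (L + ‖g‖) * ‖xnext - x‖ - (1 / (2 * a) - ρbar / 2) * ‖xnext - x‖ ^ 2 := by
  have h1 := hxhat.growth (by simpa using hh.add hr) xnext
  have h2 := hxnext.growth hr xhat
  have expand (y : 𝔼 n) : 1 / a / 2 * ‖y - (x - a • g)‖ ^ 2 =
      1 / (2 * a) * ‖y - x‖ ^ 2 + inner ℝ g (y - x) + a / 2 * ‖g‖ ^ 2 := by
    have : y - (x - a • g) = (y - x) + a • g := by abel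
    rw [this, norm_add_sq_real, norm_smul, real_inner_smul_right, mul_pow, Real.norm_eq_abs,
      sq_abs, real_inner_comm]
    field_simp
  rw [expand, expand, norm_sub_rev xhat xnext] at h2
  have h3 := (abs_le.1 (hlip xnext x)).2
  have h4 := (abs_le.1 (abs_real_inner_le_norm g (xnext - x))).1
  have h5 : (1 / a - 0) / 2 = 1 / (2 * a) := by rw [sub_zero, div_div, mul_comm]
  rw [h5] at h2
  linarith

/-- The slack used to absorb error terms in the descent inequality. -/
noncomputable def slack (ρ ρbar : ℝ) : ℝ := ρ / (2 * ρbar) * (ρbar - ρ) / 6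

/-- The constant part of the variance term of the descent inequality. -/
noncomputable def descentConst (L ρ ρbar M : ℝ) : ℝ :=
  4 * M * L / ρbar ^ 2 + M ^ 2 * ρ ^ 2 / (2 * slack ρ ρbar * ρbar ^ 5) + ρbar * L ^ 2 / slack ρ ρbar

/-- The coefficient of `‖g‖²` in the variance term of the descent inequality. -/
noncomputable def descentCoeff (ρ ρbar : ℝ) : ℝ := ρbar / slack ρ ρbar

/-- The weight of the model gap in the descent inequality with stepsize `a`. -/
noncomputable def gapWeight (ρ ρbar a : ℝ) : ℝ :=
  2 * a / (1 + (1 - ρ / (2 * ρbar)) * (a * (ρbar - ρ)))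

lemma slack_pos {ρ ρbar : ℝ} (hρ : 0 < ρ) (hρbar : ρ < ρbar) : 0 < slack ρ ρbar := by
  have : 0 < ρbar := hρ.trans hρbar
  have := sub_pos.2 hρbar
  unfold slack; positivity

lemma gapWeight_nonneg {ρ ρbar a : ℝ} (hρ : 0 < ρ) (hρbar : ρ < ρbar) (ha : 0 < a) :
    0 ≤ gapWeight ρ ρbar a := by
  have h0 : 0 < ρbar := hρ.trans hρbar
  have := sub_pos.2 hρbar
  have : ρ / (2 * ρbar) ≤ 1 := by rw [div_le_one (by positivity)]; linarith
  have := sub_nonneg.2 this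
  unfold gapWeight; positivity

/-- As `a` approaches `1 / ρbar` the negative quadratic in `q` degenerates. Borrowing `ε q² ≤ 2ε(A²
+ b²)` keeps a coefficient of order `1 / a`, so the remainder in `K²` keeps a factor `a`. -/
lemma scalar_young {K q A b δ ε a ρbar : ℝ} (hρbar : 0 < ρbar) (ha : 0 < a) (hε : 0 < ε)
    (hA : 0 ≤ A) (hb : 0 ≤ b) (hq0 : 0 ≤ q) (hq : q ≤ A + b) (hδ : 2 * ε / ρbar ≤ δ + 2 * a * ε) :
    K * q - δ / (2 * a) * q ^ 2 ≤ 2 * ε * (A ^ 2 + b ^ 2) + a * ρbar / (4 * ε) * K ^ 2 := by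
  have h1 : q ^ 2 ≤ 2 * (A ^ 2 + b ^ 2) := by nlinarith [sq_nonneg (A - b)]
  have h2 : ε / (ρbar * a) ≤ δ / (2 * a) + ε := by
    have : (2 * ε / ρbar) / (2 * a) ≤ (δ + 2 * a * ε) / (2 * a) := by gcongr
    calc ε / (ρbar * a) = (2 * ε / ρbar) / (2 * a) := by field_simp
      _ ≤ _ := this
      _ = _ := by field_simp
  have h3 : K * q ≤ ε / (ρbar * a) * q ^ 2 + a * ρbar / (4 * ε) * K ^ 2 := by
    have : ε / (ρbar * a) * q ^ 2 + a * ρbar / (4 * ε) * K ^ 2 - K * q =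
        ε / (ρbar * a) * (q - K * (ρbar * a) / (2 * ε)) ^ 2 := by
      field_simp
      ring
    have : 0 ≤ ε / (ρbar * a) * (q - K * (ρbar * a) / (2 * ε)) ^ 2 := by positivity
    linarith
  nlinarith [mul_le_mul_of_nonneg_right h2 (sq_nonneg q), mul_le_mul_of_nonneg_left h1 hε.le]

/-- Since `a < 1 / ρbar`, the powers of `a` above the second are turned into constants. -/
lemma scalar_error {L ρ ρbar a M G ε : ℝ} (hL : 0 ≤ L) (hρ : 0 < ρ) (hρbar : 0 < ρbar)
    (hM : 0 ≤ M) (ha : 0 < a) (ha' : a < 1 / ρbar) (hε : 0 < ε) :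
    4 * a ^ 4 * M * L + a * (a ^ 3 * M * ρ) ^ 2 / (2 * ε)
      + a ^ 2 * ρbar / (2 * ε) * (L + G) ^ 2 ≤
    a ^ 2 * (4 * M * L / ρbar ^ 2 + M ^ 2 * ρ ^ 2 / (2 * ε * ρbar ^ 5) + ρbar * L ^ 2 / ε
      + ρbar / ε * G ^ 2) := by
  have hpow (k : ℕ) : a ^ k ≤ 1 / ρbar ^ k := by
    rw [← one_div_pow]; exact pow_le_pow_left₀ ha.le ha'.le k
  have e1 : 4 * a ^ 4 * M * L ≤ a ^ 2 * (4 * M * L / ρbar ^ 2) := by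
    calc 4 * a ^ 4 * M * L = a ^ 2 * (4 * M * L * a ^ 2) := by ring
      _ ≤ a ^ 2 * (4 * M * L * (1 / ρbar ^ 2)) := by gcongr; exact hpow 2
      _ = _ := by ring
  have e2 : a * (a ^ 3 * M * ρ) ^ 2 / (2 * ε) ≤
      a ^ 2 * (M ^ 2 * ρ ^ 2 / (2 * ε * ρbar ^ 5)) := by
    calc a * (a ^ 3 * M * ρ) ^ 2 / (2 * ε) = a ^ 2 * (M ^ 2 * ρ ^ 2 / (2 * ε) * a ^ 5) := by ring
      _ ≤ a ^ 2 * (M ^ 2 * ρ ^ 2 / (2 * ε) * (1 / ρbar ^ 5)) := by gcongr; exact hpow 5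
      _ = _ := by field_simp
  have e3 : a ^ 2 * ρbar / (2 * ε) * (L + G) ^ 2 ≤
      a ^ 2 * (ρbar * L ^ 2 / ε + ρbar / ε * G ^ 2) := by
    have : (L + G) ^ 2 ≤ 2 * (L ^ 2 + G ^ 2) := by nlinarith [sq_nonneg (L - G)]
    calc a ^ 2 * ρbar / (2 * ε) * (L + G) ^ 2
        ≤ a ^ 2 * ρbar / (2 * ε) * (2 * (L ^ 2 + G ^ 2)) := by gcongr
      _ = _ := by field_simp
  linarith

/-- Divide by `1 + (1 - η)γ`. The choice `6aε = ηγ` and the bound `γ ≤ 1 - 2η` leave exactly the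
factor `1 - γ` on `b²`. The term `W` keeps its exact weight because its sign is unknown. -/
lemma scalar_contraction {A b W C a γ η ε : ℝ} (hη0 : 0 < η) (hη1 : 2 * η < 1)
    (hγ0 : 0 < γ) (hγ1 : γ ≤ 1 - 2 * η) (haε : 6 * a * ε = η * γ) (hC : 0 ≤ C)
    (h : (1 + γ - 4 * a * ε) * A ^ 2 ≤ (1 - γ + 6 * a * ε) * b ^ 2 + 2 * a * W + C) :
    A ^ 2 ≤ (1 - γ) * b ^ 2 + 2 * a / (1 + (1 - η) * γ) * W + C := by
  have hQ : 1 ≤ 1 + (1 - η) * γ := by nlinarith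
  have e1 : (1 + (1 - η) * γ) * A ^ 2 ≤ (1 + γ - 4 * a * ε) * A ^ 2 := by
    gcongr
    nlinarith
  have e2 : (1 - γ + 6 * a * ε) * b ^ 2 ≤ (1 + (1 - η) * γ) * (1 - γ) * b ^ 2 := by
    gcongr
    rw [haε]
    have : (1 - η) * γ ≤ 1 - 2 * η := by nlinarith
    nlinarith [mul_le_mul_of_nonneg_left this hγ0.le]
  have e3 : C ≤ (1 + (1 - η) * γ) * C := le_mul_of_one_le_left hC hQ
  have hQ0 : 0 < 1 + (1 - η) * γ := by linarith
  refine le_of_mul_le_mul_left ?_ hQ0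
  generalize 1 + (1 - η) * γ = Q at *
  have : Q * (2 * a / Q * W) = 2 * a * W := by
    rw [← mul_assoc, mul_div_cancel₀ _ hQ0.ne']
  linarith

lemma prox_step {h r : (𝔼 n) → ℝ} {L ρ ρbar a M : ℝ} (hL : 0 ≤ L) (hρ : 0 < ρ) (hρbar : ρ < ρbar)
    (hM : 0 ≤ M) (hh : IsWeaklyConvex h ρ) (hlip : ∀ x y, |h x - h y| ≤ L * ‖x - y‖)
    (hr : IsWeaklyConvex r 0) (ha : 0 < a) (ha' : a < 1 / ρbar)
    {x xhat xnext g : 𝔼 n} (hxhat : IsProxPoint (fun y => h y + r y) ρbar x xhat)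
    (hxnext : IsProxPoint r (1 / a) (x - a • g) xnext) :
    ‖xnext - xhat‖ ^ 2 ≤ (1 - a * (ρbar - ρ)) * ‖xhat - x‖ ^ 2
      + gapWeight ρ ρbar a * modelGap h ρ (a ^ 3 * M) L x (xhat - x) g
      + a ^ 2 * (descentConst L ρ ρbar M + descentCoeff ρ ρbar * ‖g‖ ^ 2) := by
  have h0 : 0 < ρbar := hρ.trans hρbar
  have hm : 0 < ρbar - ρ := sub_pos.2 hρbar
  have hε := slack_pos hρ hρbar
  have hslack : slack ρ ρbar = ρ / (2 * ρbar) * (ρbar - ρ) / 6 := rfl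
  have haρ : a * ρbar < 1 := by rwa [lt_div_iff₀ h0] at ha'
  have hbasic := prox_step_basic hh hlip hr ha hxhat hxnext
  have hW : h x - h xhat + inner ℝ g (xhat - x) =
      modelGap h ρ (a ^ 3 * M) L x (xhat - x) g + ρ / 2 * ‖xhat - x‖ ^ 2
        + a ^ 3 * M * (2 * L + ρ * ‖xhat - x‖) := by
    rw [modelGap, add_sub_cancel]; ring
  rw [hW] at hbasic
  have htri : ‖xnext - x‖ ≤ ‖xnext - xhat‖ + ‖xhat - x‖ := norm_sub_le_norm_sub_add_norm_sub _ _ _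
  have hA := norm_nonneg (xnext - xhat)
  have hb := norm_nonneg (xhat - x)
  have hq := norm_nonneg (xnext - x)
  have hG := norm_nonneg g
  unfold gapWeight descentConst descentCoeff
  generalize modelGap h ρ (a ^ 3 * M) L x (xhat - x) g = W at *
  generalize ‖xnext - xhat‖ = A at *
  generalize ‖xhat - x‖ = b at *
  generalize ‖xnext - x‖ = q at *
  generalize ‖g‖ = G at *
  clear hW hxhat hxnext hlip hh hr
  set η : ℝ := ρ / (2 * ρbar) with hη
  have hη0 : 0 < η := by positivity
  have hηρ : ρ = 2 * ρbar * η := by rw [hη]; field_simp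
  have hη1 : 2 * η < 1 := by
    by_contra! hc
    nlinarith
  generalize slack ρ ρbar = ε at *
  -- The inequality is affine in `a`: an equality at `a = 1 / ρbar`, and `2ε ≤ ρbar` at `a = 0`.
  have hδ : 2 * ε / ρbar ≤ (1 - a * ρbar) + 2 * a * ε := by
    rw [div_le_iff₀ h0]
    have : 2 * ε ≤ ρbar := by nlinarith
    nlinarith [mul_nonneg (sub_nonneg.2 haρ.le) (sub_nonneg.2 this)]
  have hy := scalar_young (K := L + G) h0 ha hε hA hb hq htri hδ
  have e1 : (1 - a * ρbar) / (2 * a) = 1 / (2 * a) - ρbar / 2 := by field_simp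
  rw [e1] at hy
  have hcross : a ^ 3 * M * ρ * b ≤ ε * b ^ 2 + (a ^ 3 * M * ρ) ^ 2 / (4 * ε) := by
    have : ε * b ^ 2 + (a ^ 3 * M * ρ) ^ 2 / (4 * ε) - a ^ 3 * M * ρ * b =
        ε * (b - a ^ 3 * M * ρ / (2 * ε)) ^ 2 := by
      field_simp
      ring
    have : 0 ≤ ε * (b - a ^ 3 * M * ρ / (2 * ε)) ^ 2 := by positivity
    linarith
  -- Young's inequality takes `2ε` from each square, and the cross term a further `ε` from `b²`;
  -- doubling by `2a` produces the `4aε` and `6aε` of `scalar_contraction`.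
  have hsum : (1 / (2 * a) + (ρbar - ρ) / 2 - 2 * ε) * A ^ 2 ≤
      (1 / (2 * a) - (ρbar - ρ) / 2 + 3 * ε) * b ^ 2 + W + 2 * a ^ 3 * M * L
        + (a ^ 3 * M * ρ) ^ 2 / (4 * ε) + a * ρbar / (4 * ε) * (L + G) ^ 2 := by
    linarith
  have hsum2 : (1 + a * (ρbar - ρ) - 4 * a * ε) * A ^ 2 ≤
      (1 - a * (ρbar - ρ) + 6 * a * ε) * b ^ 2 + 2 * a * W + 4 * a ^ 4 * M * L
        + a * (a ^ 3 * M * ρ) ^ 2 / (2 * ε) + a ^ 2 * ρbar / (2 * ε) * (L + G) ^ 2 := by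
    have := mul_le_mul_of_nonneg_left hsum (by positivity : 0 ≤ 2 * a)
    have e2 : 2 * a * ((1 / (2 * a) + (ρbar - ρ) / 2 - 2 * ε) * A ^ 2) =
      (1 + a * (ρbar - ρ) - 4 * a * ε) * A ^ 2 := by field_simp; ring
    have e3 : 2 * a * ((1 / (2 * a) - (ρbar - ρ) / 2 + 3 * ε) * b ^ 2 + W + 2 * a ^ 3 * M * L
        + (a ^ 3 * M * ρ) ^ 2 / (4 * ε) + a * ρbar / (4 * ε) * (L + G) ^ 2) =
      (1 - a * (ρbar - ρ) + 6 * a * ε) * b ^ 2 + 2 * a * W + 4 * a ^ 4 * M * L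
        + a * (a ^ 3 * M * ρ) ^ 2 / (2 * ε) + a ^ 2 * ρbar / (2 * ε) * (L + G) ^ 2 := by
      field_simp
      ring
    rwa [e2, e3] at this
  have herr := scalar_error (G := G) hL hρ h0 hM ha ha' hε
  set γ : ℝ := a * (ρbar - ρ) with hγ
  have hγ0 : 0 < γ := by positivity
  have hγ1 : γ ≤ 1 - 2 * η := by
    have : γ = a * ρbar * (1 - 2 * η) := by rw [hγ, hηρ]; ring
    rw [this]
    nlinarith
  have haε : 6 * a * ε = η * γ := by rw [hslack, hγ]; ring
  refine (scalar_contraction (C := a ^ 2 * (4 * M * L / ρbar ^ 2 + M ^ 2 * ρ ^ 2 / (2 * ε * ρbar ^ 5)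
    + ρbar * L ^ 2 / ε + ρbar / ε * G ^ 2)) hη0 hη1 hγ0 hγ1 haε (by positivity) ?_)
  linarith

/-! ### The stochastic problem and its two-point oracle. -/

/-- The standing assumptions on a stochastic composite problem `min E[F(x; ξ)] + r(x)`. -/
structure IsProblem {Ξ : Type*} [MeasurableSpace Ξ] (P : Measure Ξ) (F : (𝔼 n) → Ξ → ℝ)
    (r : (𝔼 n) → ℝ) (L ρ m : ℝ) : Prop where
  nonneg : 0 ≤ L
  pos : 0 < ρ
  measurable : Measurable (Function.uncurry F)
  integrable : ∀ x, Integrable (F x) P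
  integrable_sq : ∀ x y, Integrable (fun s => (F x s - F y s) ^ 2) P
  lipschitz : ∀ x y, ∫ s, (F x s - F y s) ^ 2 ∂P ≤ L ^ 2 * ‖x - y‖ ^ 2
  weaklyConvex : IsWeaklyConvex (expected P F) ρ
  convex : IsWeaklyConvex r 0
  le : ∀ x, m ≤ expected P F x + r x

/-- The law of one sample `(ξ, z₁, z₂)`. -/
noncomputable def sampleLaw (n : ℕ) {Ξ : Type*} [MeasurableSpace Ξ] (P : Measure Ξ) :
    Measure (Ξ × (𝔼 n) × (𝔼 n)) :=
  P.prod ((stdGaussian (𝔼 n)).prod (stdGaussian (𝔼 n)))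

instance {Ξ : Type*} [MeasurableSpace Ξ] (P : Measure Ξ) [IsProbabilityMeasure P] :
    IsProbabilityMeasure (sampleLaw n P) := by
  unfold sampleLaw; infer_instance

/-- The two-point estimate as a function of the sample `(ξ, z₁, z₂)`. -/
noncomputable def oracle {Ξ : Type*} (F : (𝔼 n) → Ξ → ℝ) (u₁ u₂ : ℝ) (x : 𝔼 n)
    (s : Ξ × (𝔼 n) × (𝔼 n)) : 𝔼 n :=
  twoPoint F x u₁ u₂ s.2.1 s.2.2 s.1

section

variable {Ξ : Type*} [MeasurableSpace Ξ]

lemma measurable_oracle {F : (𝔼 n) → Ξ → ℝ} (hF : Measurable (Function.uncurry F)) (u₁ u₂ : ℝ) :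
    Measurable fun p : (𝔼 n) × (Ξ × (𝔼 n) × (𝔼 n)) => oracle F u₁ u₂ p.1 p.2 := by
  unfold oracle twoPoint
  have h1 : Measurable fun p : (𝔼 n) × (Ξ × (𝔼 n) × (𝔼 n)) =>
      F (p.1 + u₁ • p.2.2.1 + u₂ • p.2.2.2) p.2.1 :=
    hF.comp (by fun_prop : Measurable fun p : (𝔼 n) × (Ξ × (𝔼 n) × (𝔼 n)) =>
      (p.1 + u₁ • p.2.2.1 + u₂ • p.2.2.2, p.2.1))
  have h2 : Measurable fun p : (𝔼 n) × (Ξ × (𝔼 n) × (𝔼 n)) =>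
      F (p.1 + u₁ • p.2.2.1) p.2.1 :=
    hF.comp (by fun_prop : Measurable fun p : (𝔼 n) × (Ξ × (𝔼 n) × (𝔼 n)) =>
      (p.1 + u₁ • p.2.2.1, p.2.1))
  exact ((h1.sub h2).div_const u₂).smul (by fun_prop)

lemma measurable_oracle_comp {Ω : Type*} [MeasurableSpace Ω] {F : (𝔼 n) → Ξ → ℝ}
    (hF : Measurable (Function.uncurry F)) (u₁ u₂ : ℝ) {X : Ω → 𝔼 n}
    {S : Ω → Ξ × (𝔼 n) × (𝔼 n)} (hX : Measurable X) (hS : Measurable S) :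
    Measurable fun ω => oracle F u₁ u₂ (X ω) (S ω) := by
  have := (measurable_oracle hF u₁ u₂).comp (hX.prodMk hS)
  exact this

lemma measurable_oracle_right {F : (𝔼 n) → Ξ → ℝ} (hF : Measurable (Function.uncurry F))
    (u₁ u₂ : ℝ) (x : 𝔼 n) : Measurable (oracle F u₁ u₂ x) :=
  measurable_oracle_comp hF u₁ u₂ measurable_const measurable_id

variable {P : Measure Ξ} {F : (𝔼 n) → Ξ → ℝ} {r : (𝔼 n) → ℝ} {L ρ m : ℝ}

lemma IsProblem.isWeaklyConvex_objective (h : IsProblem P F r L ρ m) :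
    IsWeaklyConvex (fun x => expected P F x + r x) ρ := by
  simpa using h.weaklyConvex.add h.convex

lemma IsProblem.exists_isProxPoint_objective (h : IsProblem P F r L ρ m) {lam : ℝ}
    (hlam : 0 < lam) (x : 𝔼 n) : ∃ p, IsProxPoint (fun x => expected P F x + r x) lam x p :=
  exists_isProxPoint h.isWeaklyConvex_objective.continuous (a := m) hlam le_rfl
    (fun y => by simpa using h.le y) x

variable [IsProbabilityMeasure P]

lemma sq_integral_le {g : Ξ → ℝ} (hg : Integrable g P) (hg2 : Integrable (fun s => g s ^ 2) P) :
    (∫ s, g s ∂P) ^ 2 ≤ ∫ s, g s ^ 2 ∂P := by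
  set c := ∫ s, g s ∂P with hc
  have h1 : 0 ≤ ∫ s, (g s ^ 2 - 2 * c * g s + c ^ 2) ∂P :=
    integral_nonneg fun s => by
      simp only [Pi.zero_apply]
      nlinarith [sq_nonneg (g s - c)]
  have h2 : Integrable (fun s => g s ^ 2 - 2 * c * g s) P := hg2.sub (hg.const_mul _)
  rw [integral_add h2 (integrable_const _),
    integral_sub hg2 (hg.const_mul _), integral_const_mul, ← hc] at h1
  simp only [integral_const, probReal_univ, smul_eq_mul, one_mul] at h1
  linarith

lemma IsProblem.abs_expected_sub_le (h : IsProblem P F r L ρ m) (x y : 𝔼 n) :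
    |expected P F x - expected P F y| ≤ L * ‖x - y‖ := by
  have hL := h.nonneg
  have h1 := sq_integral_le ((h.integrable x).sub (h.integrable y)) (h.integrable_sq x y)
  simp only [Pi.sub_apply] at h1
  rw [integral_sub (h.integrable x) (h.integrable y)] at h1
  refine abs_le_of_sq_le_sq ?_ (by positivity)
  rw [mul_pow]
  exact h1.trans (h.lipschitz x y)

/-- Integrate over `ξ` first: the mean-square Lipschitz bound contributes `u₂²‖z₂‖²`, which cancels
the denominator and leaves `L²‖z₂‖⁴`. Working with `lintegral` yields integrability as a
consequence. -/
lemma IsProblem.lintegral_oracle_sq_le (h : IsProblem P F r L ρ m) {u₁ u₂ : ℝ} (hu₂ : 0 < u₂)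
    (x : 𝔼 n) :
    ∫⁻ s, ENNReal.ofReal (‖oracle F u₁ u₂ x s‖ ^ 2) ∂(sampleLaw n P) ≤
      ENNReal.ofReal (L ^ 2 * gaussianMoment n 4) := by
  have hmeas := measurable_oracle_right h.measurable u₁ u₂ x
  rw [sampleLaw, lintegral_prod_symm _ (by fun_prop)]
  calc ∫⁻ z, ∫⁻ s, ENNReal.ofReal (‖oracle F u₁ u₂ x (s, z)‖ ^ 2) ∂P
        ∂((stdGaussian (𝔼 n)).prod (stdGaussian (𝔼 n)))
      ≤ ∫⁻ z : (𝔼 n) × (𝔼 n), ENNReal.ofReal (L ^ 2 * ‖z.2‖ ^ 4)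
        ∂((stdGaussian (𝔼 n)).prod (stdGaussian (𝔼 n))) := by
        refine lintegral_mono fun z => ?_
        have e1 (s : Ξ) : ‖oracle F u₁ u₂ x (s, z)‖ ^ 2 =
            (F (x + u₁ • z.1 + u₂ • z.2) s - F (x + u₁ • z.1) s) ^ 2 * (‖z.2‖ ^ 2 / u₂ ^ 2) := by
          simp only [oracle, twoPoint]
          rw [norm_smul, mul_pow, Real.norm_eq_abs, sq_abs, div_pow]
          ring
        simp_rw [e1]
        rw [← ofReal_integral_eq_lintegral_ofReal ((h.integrable_sq _ _).mul_const _)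
          (Filter.Eventually.of_forall fun s => by positivity), integral_mul_const]
        refine ENNReal.ofReal_le_ofReal ?_
        have e2 := h.lipschitz (x + u₁ • z.1 + u₂ • z.2) (x + u₁ • z.1)
        rw [add_sub_cancel_left, norm_smul, Real.norm_of_nonneg hu₂.le] at e2
        calc _ ≤ L ^ 2 * (u₂ * ‖z.2‖) ^ 2 * (‖z.2‖ ^ 2 / u₂ ^ 2) := by gcongr
          _ = _ := by field_simp
    _ = ENNReal.ofReal (L ^ 2 * gaussianMoment n 4) := by
        rw [lintegral_prod _ (by fun_prop)]
        simp only [lintegral_const, measure_univ, mul_one]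
        rw [← ofReal_integral_eq_lintegral_ofReal
          ((integrable_norm_pow_stdGaussian 4).const_mul _)
          (Filter.Eventually.of_forall fun s => by positivity), integral_const_mul, gaussianMoment]

lemma IsProblem.integrable_oracle_sq (h : IsProblem P F r L ρ m) {u₁ u₂ : ℝ} (hu₂ : 0 < u₂)
    (x : 𝔼 n) : Integrable (fun s => ‖oracle F u₁ u₂ x s‖ ^ 2) (sampleLaw n P) := by
  have hmeas := measurable_oracle_right h.measurable u₁ u₂ x
  refine ⟨by fun_prop, ?_⟩
  rw [hasFiniteIntegral_iff_ofReal (Filter.Eventually.of_forall fun s => by positivity)]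
  exact (h.lintegral_oracle_sq_le hu₂ x).trans_lt ENNReal.ofReal_lt_top

lemma IsProblem.integrable_inner_oracle (h : IsProblem P F r L ρ m) {u₁ u₂ : ℝ} (hu₂ : 0 < u₂)
    (x d : 𝔼 n) : Integrable (fun s => inner ℝ (oracle F u₁ u₂ x s) d) (sampleLaw n P) := by
  have hmeas := measurable_oracle_right h.measurable u₁ u₂ x
  refine (((integrable_const (1 : ℝ)).add (h.integrable_oracle_sq (u₁ := u₁) hu₂ x)).mul_const
    ‖d‖).mono' (by fun_prop) (Filter.Eventually.of_forall fun s => ?_)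
  refine (abs_real_inner_le_norm _ _).trans ?_
  simp only [Pi.add_apply]
  gcongr
  nlinarith [sq_nonneg (‖oracle F u₁ u₂ x s‖ - 1)]

/-- Integrate over `ξ`, then over `z₂` with `z₁` frozen, applying the directional bound for `f` at
`x + u₁ z₁`; the remaining integral over `z₁` turns `f` into its smoothing. -/
lemma IsProblem.integral_inner_oracle_le (h : IsProblem P F r L ρ m) {u₁ u₂ : ℝ} (hu₂ : 0 < u₂)
    (x d : 𝔼 n) :
    ∫ s, inner ℝ (oracle F u₁ u₂ x s) d ∂(sampleLaw n P) ≤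
      smooth (expected P F) u₁ (x + d) - smooth (expected P F) u₁ x + ρ / 2 * ‖d‖ ^ 2
        + u₂ * gaussianMoment n 3 * (2 * L + ρ * ‖d‖) := by
  set f := expected P F with hf
  have hint := h.integrable_inner_oracle (u₁ := u₁) hu₂ x d
  have hs (y : 𝔼 n) := integrable_smooth h.weaklyConvex.continuous h.abs_expected_sub_le u₁ y
  have e1 (z : (𝔼 n) × (𝔼 n)) : ∫ s, inner ℝ (oracle F u₁ u₂ x (s, z)) d ∂P =
      (f (x + u₁ • z.1 + u₂ • z.2) - f (x + u₁ • z.1)) / u₂ * inner ℝ z.2 d := by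
    simp only [oracle, twoPoint, real_inner_smul_left]
    rw [integral_mul_const, integral_div, integral_sub (h.integrable _) (h.integrable _)]
    rfl
  rw [sampleLaw] at hint ⊢
  have hint2 := hint.integral_prod_right
  rw [integral_prod_symm _ hint]
  simp_rw [e1] at hint2 ⊢
  have hint3 := hint2.integral_prod_left
  rw [integral_prod _ hint2]
  have hc : Integrable (fun _ : 𝔼 n => ρ / 2 * ‖d‖ ^ 2
        + u₂ * gaussianMoment n 3 * (2 * L + ρ * ‖d‖)) (stdGaussian (𝔼 n)) := integrable_const _
  have hsub : Integrable (fun z => f (x + d + u₁ • z) - f (x + u₁ • z)) (stdGaussian (𝔼 n)) :=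
    (hs (x + d)).sub (hs x)
  calc _ ≤ ∫ z, (f (x + d + u₁ • z) - f (x + u₁ • z) + (ρ / 2 * ‖d‖ ^ 2
        + u₂ * gaussianMoment n 3 * (2 * L + ρ * ‖d‖))) ∂(stdGaussian (𝔼 n)) := by
        refine integral_mono hint3 (hsub.add hc) fun z => ?_
        have := integral_difference_mul_inner_le h.nonneg h.pos.le hu₂ h.weaklyConvex
          h.abs_expected_sub_le (x + u₁ • z) d
        have e2 : x + u₁ • z + d = x + d + u₁ • z := by abel
        rw [e2] at this
        simp only
        linarith
    _ = _ := by
        rw [integral_add hsub hc, integral_sub (hs _) (hs _)]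
        simp only [smooth, integral_const, probReal_univ, smul_eq_mul, one_mul]
        ring

lemma IsProblem.abs_smooth_sub_le (h : IsProblem P F r L ρ m) {w : ℝ} (hw : 0 ≤ w) (x : 𝔼 n) :
    |smooth (expected P F) w x - expected P F x| ≤ w * (L * gaussianMoment n 1) :=
  ZeroOrder.abs_smooth_sub_le h.weaklyConvex.continuous h.abs_expected_sub_le hw x

lemma IsProblem.isWeaklyConvex_smoothed (h : IsProblem P F r L ρ m) (w : ℝ) :
    IsWeaklyConvex (fun x => smooth (expected P F) w x + r x) ρ := by
  simpa using (h.weaklyConvex.smooth h.abs_expected_sub_le w).add h.convex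

lemma IsProblem.exists_isProxPoint_smoothed (h : IsProblem P F r L ρ m) {lam : ℝ}
    (hlam : 0 < lam) {w : ℝ} (hw : 0 ≤ w) (x : 𝔼 n) :
    ∃ p, IsProxPoint (fun x => smooth (expected P F) w x + r x) lam x p :=
  exists_isProxPoint (h.isWeaklyConvex_smoothed w).continuous
    (a := m - w * (L * gaussianMoment n 1)) hlam le_rfl
    (fun y => by
      have := (abs_le.1 (h.abs_smooth_sub_le hw y)).1
      have := h.le y
      linarith) x

/-- Since `f + r ≥ m` and `f` is `L`-Lipschitz, `r` decreases at most linearly, so the minimizer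
selected by `prox` exists. -/
lemma IsProblem.isProxPoint_prox (h : IsProblem P F r L ρ m) {a : ℝ} (ha : 0 < a) (x : 𝔼 n) :
    IsProxPoint r (1 / a) x (prox a r x) :=
  ZeroOrder.isProxPoint_prox <| exists_isProxPoint h.convex.continuous
    (a := m - expected P F 0) (by positivity) h.nonneg
    (fun y => by
      have h1 := (abs_le.1 (h.abs_expected_sub_le y 0)).2
      have := h.le y
      rw [sub_zero] at h1
      linarith) x

end

/-! ### Descent in expectation for a square-integrable random point. -/

lemma memLp_two_comp {Ω G : Type*} [MeasurableSpace Ω] {μ : Measure Ω} [IsProbabilityMeasure μ]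
    [NormedAddCommGroup G] {X : Ω → 𝔼 n} (hX : MemLp X 2 μ) {q : (𝔼 n) → G}
    (hq : Continuous q) {K : ℝ} (hK : ∀ x y, ‖q x - q y‖ ≤ K * ‖x - y‖) :
    MemLp (fun ω => q (X ω)) 2 μ := by
  refine ((memLp_const ‖q 0‖).add (hX.norm.const_mul K)).mono'
    (hq.comp_aestronglyMeasurable hX.1) (Filter.Eventually.of_forall fun ω => ?_)
  have h1 := hK (X ω) 0
  have h2 := norm_le_norm_sub_add (q (X ω)) (q 0)
  rw [sub_zero] at h1
  simp only [Pi.add_apply]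
  linarith

lemma norm_sub_le_of_isProxPoint {w : (𝔼 n) → ℝ} {σ lam : ℝ} (hw : IsWeaklyConvex w σ)
    (hlam : 0 ≤ lam) (hσ : σ < lam) {p : (𝔼 n) → 𝔼 n} (hp : ∀ x, IsProxPoint w lam x (p x))
    (x y : 𝔼 n) : ‖p x - p y‖ ≤ lam / (lam - σ) * ‖x - y‖ := by
  rw [div_mul_eq_mul_div, le_div_iff₀ (sub_pos.2 hσ), mul_comm]
  exact (hp x).norm_sub_le hw hlam (hp y)

lemma continuous_of_isProxPoint {w : (𝔼 n) → ℝ} {σ lam : ℝ} (hw : IsWeaklyConvex w σ)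
    (hlam : 0 ≤ lam) (hσ : σ < lam) {p : (𝔼 n) → 𝔼 n} (hp : ∀ x, IsProxPoint w lam x (p x)) :
    Continuous p := by
  have : LipschitzWith (lam / (lam - σ)).toNNReal p := by
    refine LipschitzWith.of_dist_le_mul fun x y => ?_
    rw [dist_eq_norm, dist_eq_norm, Real.coe_toNNReal _ (div_nonneg hlam (sub_pos.2 hσ).le)]
    exact norm_sub_le_of_isProxPoint hw hlam hσ hp x y
  exact this.continuous

section

variable {Ξ Ω : Type*} [MeasurableSpace Ξ] [MeasurableSpace Ω] {P : Measure Ξ}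
  {F : (𝔼 n) → Ξ → ℝ} {r : (𝔼 n) → ℝ} {L ρ m ρbar : ℝ}

lemma IsProblem.differentiable_moreau_objective (h : IsProblem P F r L ρ m) (hρbar : ρ < ρbar) :
    Differentiable ℝ (moreau (fun x => expected P F x + r x) ρbar) := by
  have h0 : 0 < ρbar := h.pos.trans hρbar
  choose p hp using h.exists_isProxPoint_objective h0
  exact fun x => (hasGradientAt_moreau h.isWeaklyConvex_objective h0.le hρbar hp x).differentiableAt

lemma IsProblem.moreau_objective_le (h : IsProblem P F r L ρ m) (h0 : 0 < ρbar) (x y : 𝔼 n) :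
    moreau (fun x => expected P F x + r x) ρbar x ≤
      expected P F y + r y + ρbar / 2 * ‖y - x‖ ^ 2 := by
  obtain ⟨p, hp⟩ := h.exists_isProxPoint_objective h0 x
  rw [hp.moreau_eq]
  exact hp y

lemma IsProblem.le_moreau_objective (h : IsProblem P F r L ρ m) (h0 : 0 < ρbar) (x : 𝔼 n) :
    m ≤ moreau (fun x => expected P F x + r x) ρbar x := by
  obtain ⟨p, hp⟩ := h.exists_isProxPoint_objective h0 x
  rw [hp.moreau_eq]
  have := h.le p
  have : 0 ≤ ρbar / 2 * ‖p - x‖ ^ 2 := by positivity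
  linarith

variable {μ : Measure Ω} [IsProbabilityMeasure μ]

lemma IsProblem.integrable_moreau_objective (h : IsProblem P F r L ρ m) (hρbar : ρ < ρbar)
    {X : Ω → 𝔼 n} (hX : MemLp X 2 μ) :
    Integrable (fun ω => moreau (fun x => expected P F x + r x) ρbar (X ω)) μ := by
  have h0 : 0 < ρbar := h.pos.trans hρbar
  refine (((integrable_const |m|).add (integrable_const |expected P F 0 + r 0|)).add
    ((hX.integrable_norm_pow (by norm_num)).const_mul (ρbar / 2))).mono'
    ((h.differentiable_moreau_objective hρbar).continuous.comp_aestronglyMeasurable hX.1)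
    (Filter.Eventually.of_forall fun ω => ?_)
  have h1 := h.moreau_objective_le h0 (X ω) 0
  have h2 := h.le_moreau_objective h0 (X ω)
  rw [zero_sub, norm_neg] at h1
  have h3 := neg_abs_le m
  have h4 := le_abs_self (expected P F 0 + r 0)
  have h5 := abs_nonneg m
  have h6 := abs_nonneg (expected P F 0 + r 0)
  have h7 : 0 ≤ ρbar / 2 * ‖X ω‖ ^ 2 := by positivity
  simp only [Pi.add_apply]
  rw [Real.norm_eq_abs, abs_le]
  constructor <;> linarith

variable [IsProbabilityMeasure P]

lemma IsProblem.exists_gradient_moreau_smoothed (h : IsProblem P F r L ρ m) (hρbar : ρ < ρbar)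
    {w : ℝ} (hw : 0 ≤ w) :
    ∃ p : (𝔼 n) → 𝔼 n,
      (∀ x, IsProxPoint (fun x => smooth (expected P F) w x + r x) ρbar x (p x)) ∧
      (∀ x, HasGradientAt (moreau (fun x => smooth (expected P F) w x + r x) ρbar)
        (ρbar • (x - p x)) x) ∧
      Continuous p ∧ ∀ x y, ‖p x - p y‖ ≤ ρbar / (ρbar - ρ) * ‖x - y‖ := by
  have h0 : 0 < ρbar := h.pos.trans hρbar
  choose p hp using h.exists_isProxPoint_smoothed h0 hw
  have hc := h.isWeaklyConvex_smoothed w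
  exact ⟨p, hp, hasGradientAt_moreau hc h0.le hρbar hp, continuous_of_isProxPoint hc h0.le hρbar hp,
    norm_sub_le_of_isProxPoint hc h0.le hρbar hp⟩

lemma IsProblem.moreau_smoothed_le (h : IsProblem P F r L ρ m) (h0 : 0 < ρbar) {w : ℝ}
    (hw : 0 ≤ w) (x : 𝔼 n) :
    moreau (fun x => smooth (expected P F) w x + r x) ρbar x ≤
      moreau (fun x => expected P F x + r x) ρbar x + w * (L * gaussianMoment n 1) := by
  obtain ⟨p, hp⟩ := h.exists_isProxPoint_objective h0 x
  obtain ⟨q, hq⟩ := h.exists_isProxPoint_smoothed h0 hw x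
  rw [hp.moreau_eq, hq.moreau_eq]
  have h1 := hq p
  have h2 := (abs_le.1 (h.abs_smooth_sub_le hw p)).2
  linarith

lemma IsProblem.integrable_gradient_sq (h : IsProblem P F r L ρ m) (hρbar : ρ < ρbar) {w : ℝ}
    (hw : 0 ≤ w) {X : Ω → 𝔼 n} (hX : MemLp X 2 μ) :
    Integrable (fun ω => ‖gradient
      (moreau (fun x => smooth (expected P F) w x + r x) ρbar) (X ω)‖ ^ 2) μ := by
  obtain ⟨p, -, hg, hc, hl⟩ := h.exists_gradient_moreau_smoothed hρbar hw
  simp_rw [fun x => (hg x).gradient]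
  exact ((hX.sub (memLp_two_comp hX hc hl)).const_smul ρbar).integrable_norm_pow (by norm_num)

/-- Independence makes the joint law a product, and the second-moment bound at a fixed point is
uniform in that point. -/
lemma IsProblem.integrable_oracle_comp (h : IsProblem P F r L ρ m) {X : Ω → 𝔼 n}
    {S : Ω → Ξ × (𝔼 n) × (𝔼 n)} (hXm : Measurable X) (hSm : Measurable S)
    (hS : μ.map S = sampleLaw n P) (hind : IndepFun X S μ) {u₁ u₂ : ℝ} (hu₂ : 0 < u₂) :
    Integrable (fun ω => ‖oracle F u₁ u₂ (X ω) (S ω)‖ ^ 2) μ ∧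
      ∫ ω, ‖oracle F u₁ u₂ (X ω) (S ω)‖ ^ 2 ∂μ ≤ L ^ 2 * gaussianMoment n 4 := by
  have hmeas := measurable_oracle h.measurable u₁ u₂
  have hcomp : Measurable fun ω => oracle F u₁ u₂ (X ω) (S ω) :=
    measurable_oracle_comp h.measurable _ _ hXm hSm
  have hlaw := (indepFun_iff_map_prod_eq_prod_map_map hXm.aemeasurable hSm.aemeasurable).1 hind
  rw [hS] at hlaw
  have : IsProbabilityMeasure (μ.map X) := Measure.isProbabilityMeasure_map hXm.aemeasurable
  have hM : 0 ≤ L ^ 2 * gaussianMoment n 4 := mul_nonneg (sq_nonneg _) (gaussianMoment_nonneg n 4)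
  have hle : ∫⁻ ω, ENNReal.ofReal (‖oracle F u₁ u₂ (X ω) (S ω)‖ ^ 2) ∂μ ≤
      ENNReal.ofReal (L ^ 2 * gaussianMoment n 4) := by
    have hG : Measurable fun q : (𝔼 n) × (Ξ × (𝔼 n) × (𝔼 n)) =>
      ENNReal.ofReal (‖oracle F u₁ u₂ q.1 q.2‖ ^ 2) := by fun_prop
    rw [← lintegral_map (μ := μ) hG (hXm.prodMk hSm), hlaw, lintegral_prod _ hG.aemeasurable]
    refine (lintegral_mono fun x => h.lintegral_oracle_sq_le hu₂ x).trans ?_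
    simp
  have hint : Integrable (fun ω => ‖oracle F u₁ u₂ (X ω) (S ω)‖ ^ 2) μ := by
    refine ⟨(hcomp.norm.pow_const 2).aestronglyMeasurable, ?_⟩
    rw [hasFiniteIntegral_iff_ofReal (Filter.Eventually.of_forall fun s => by positivity)]
    exact hle.trans_lt ENNReal.ofReal_lt_top
  refine ⟨hint, ?_⟩
  rwa [← ofReal_integral_eq_lintegral_ofReal hint
    (Filter.Eventually.of_forall fun s => by positivity), ENNReal.ofReal_le_ofReal_iff hM] at hle

lemma IsProblem.integrable_modelGap (h : IsProblem P F r L ρ m) {X : Ω → 𝔼 n}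
    {S : Ω → Ξ × (𝔼 n) × (𝔼 n)} (hXm : Measurable X) (hSm : Measurable S)
    (hS : μ.map S = sampleLaw n P) (hind : IndepFun X S μ) (hX : MemLp X 2 μ)
    {u₁ u₂ : ℝ} (hu₂ : 0 < u₂) {p : (𝔼 n) → 𝔼 n} (hp : Continuous p) {K : ℝ}
    (hK : ∀ x y, ‖p x - p y‖ ≤ K * ‖x - y‖) (κ : ℝ) :
    Integrable (fun ω => modelGap (smooth (expected P F) u₁) ρ κ L (X ω) (p (X ω) - X ω)
      (oracle F u₁ u₂ (X ω) (S ω))) μ := by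
  have hcomp : Measurable fun ω => oracle F u₁ u₂ (X ω) (S ω) :=
    measurable_oracle_comp h.measurable _ _ hXm hSm
  have hpX := memLp_two_comp hX hp hK
  have hd : MemLp (fun ω => p (X ω) - X ω) 2 μ := hpX.sub hX
  have hsc := (h.weaklyConvex.smooth h.abs_expected_sub_le u₁).continuous
  have hsl := abs_smooth_sub_smooth_le h.weaklyConvex.continuous h.abs_expected_sub_le u₁
  have h1 := (memLp_two_comp hX hsc hsl).integrable one_le_two
  have h2 := (memLp_two_comp hpX hsc hsl).integrable one_le_two
  have h3 := hd.integrable_norm_pow (two_ne_zero)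
  have h4 := (hd.integrable one_le_two).norm
  have h5 := (h.integrable_oracle_comp hXm hSm hS hind (u₁ := u₁) hu₂).1
  have h6 : Integrable (fun ω => inner ℝ (oracle F u₁ u₂ (X ω) (S ω)) (p (X ω) - X ω)) μ := by
    refine (h5.add h3).mono' (hcomp.aestronglyMeasurable.inner hd.1)
      (Filter.Eventually.of_forall fun ω => ?_)
    refine (abs_real_inner_le_norm _ _).trans ?_
    simp only [Pi.add_apply]
    nlinarith [sq_nonneg (‖oracle F u₁ u₂ (X ω) (S ω)‖ - ‖p (X ω) - X ω‖),
      sq_nonneg ‖oracle F u₁ u₂ (X ω) (S ω)‖, sq_nonneg ‖p (X ω) - X ω‖]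
  simp only [modelGap, add_sub_cancel]
  exact (((h1.sub h2).add h6).sub (h3.const_mul _)).sub
    (((integrable_const _).add (h4.const_mul _)).const_mul _)

lemma IsProblem.integral_modelGap_nonpos (h : IsProblem P F r L ρ m) {X : Ω → 𝔼 n}
    {S : Ω → Ξ × (𝔼 n) × (𝔼 n)} (hXm : Measurable X) (hSm : Measurable S)
    (hS : μ.map S = sampleLaw n P) (hind : IndepFun X S μ) (hX : MemLp X 2 μ)
    {u₁ u₂ : ℝ} (hu₂ : 0 < u₂) {p : (𝔼 n) → 𝔼 n} (hp : Continuous p) {K : ℝ}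
    (hK : ∀ x y, ‖p x - p y‖ ≤ K * ‖x - y‖) :
    ∫ ω, modelGap (smooth (expected P F) u₁) ρ (u₂ * gaussianMoment n 3) L (X ω) (p (X ω) - X ω)
      (oracle F u₁ u₂ (X ω) (S ω)) ∂μ ≤ 0 := by
  have hint := h.integrable_modelGap hXm hSm hS hind hX (u₁ := u₁) hu₂ hp hK
    (u₂ * gaussianMoment n 3)
  have hlaw := (indepFun_iff_map_prod_eq_prod_map_map hXm.aemeasurable hSm.aemeasurable).1 hind
  rw [hS] at hlaw
  have : IsProbabilityMeasure (μ.map X) := Measure.isProbabilityMeasure_map hXm.aemeasurable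
  set G : (𝔼 n) × (Ξ × (𝔼 n) × (𝔼 n)) → ℝ := fun q =>
    modelGap (smooth (expected P F) u₁) ρ (u₂ * gaussianMoment n 3) L q.1 (p q.1 - q.1)
      (oracle F u₁ u₂ q.1 q.2) with hG
  have hGm : Measurable G := by
    have e1 := measurable_oracle h.measurable u₁ u₂
    have e2 := (h.weaklyConvex.smooth h.abs_expected_sub_le u₁).continuous.measurable
    have e3 := hp.measurable
    simp only [hG, modelGap]
    fun_prop
  have hXS := hXm.prodMk hSm
  have e1 : ∫ ω, G (X ω, S ω) ∂μ = ∫ x, ∫ s, G (x, s) ∂(sampleLaw n P) ∂(μ.map X) := by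
    rw [← integral_map hXS.aemeasurable hGm.aestronglyMeasurable, hlaw, integral_prod]
    rw [← hlaw, integrable_map_measure hGm.aestronglyMeasurable hXS.aemeasurable]
    exact hint
  -- With the iterate frozen, `modelGap` is the inner product minus precisely the upper bound for
  -- its mean.
  refine e1.trans_le (integral_nonpos fun x => ?_)
  have e2 := h.integrable_inner_oracle (u₁ := u₁) hu₂ x (p x - x)
  have e3 := h.integral_inner_oracle_le (u₁ := u₁) hu₂ x (p x - x)
  have e4 (s : Ξ × (𝔼 n) × (𝔼 n)) : G (x, s) = inner ℝ (oracle F u₁ u₂ x s) (p x - x) +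
      (smooth (expected P F) u₁ x - smooth (expected P F) u₁ (x + (p x - x))
        - ρ / 2 * ‖p x - x‖ ^ 2 - u₂ * gaussianMoment n 3 * (2 * L + ρ * ‖p x - x‖)) := by
    simp only [hG, modelGap]; ring
  simp_rw [e4]
  rw [integral_add e2 (integrable_const _)]
  simp only [integral_const, probReal_univ, smul_eq_mul, one_mul, Pi.zero_apply]
  linarith

lemma IsProblem.continuous_prox (h : IsProblem P F r L ρ m) {a : ℝ} (ha : 0 < a) :
    Continuous (prox a r) :=
  continuous_of_isProxPoint h.convex (by positivity) (by positivity) (h.isProxPoint_prox ha)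

/-- One step of the method with stepsize `a` from `x` with sample `s`. -/
noncomputable def step (F : (𝔼 n) → Ξ → ℝ) (r : (𝔼 n) → ℝ) (a : ℝ) (x : 𝔼 n)
    (s : Ξ × (𝔼 n) × (𝔼 n)) : 𝔼 n :=
  prox a r (x - a • oracle F (a ^ 2) (a ^ 3) x s)

lemma IsProblem.measurable_step (h : IsProblem P F r L ρ m) {a : ℝ} (ha : 0 < a) :
    Measurable fun q : (𝔼 n) × (Ξ × (𝔼 n) × (𝔼 n)) => step F r a q.1 q.2 := by
  have := measurable_oracle h.measurable (a ^ 2) (a ^ 3)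
  exact (h.continuous_prox ha).measurable.comp (measurable_fst.sub (this.const_smul a))

lemma IsProblem.memLp_step (h : IsProblem P F r L ρ m) {X : Ω → 𝔼 n}
    {S : Ω → Ξ × (𝔼 n) × (𝔼 n)} (hXm : Measurable X) (hSm : Measurable S)
    (hS : μ.map S = sampleLaw n P) (hind : IndepFun X S μ) (hX : MemLp X 2 μ) {a : ℝ}
    (ha : 0 < a) : MemLp (fun ω => step F r a (X ω) (S ω)) 2 μ := by
  have hcomp : Measurable fun ω => oracle F (a ^ 2) (a ^ 3) (X ω) (S ω) :=
    measurable_oracle_comp h.measurable _ _ hXm hSm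
  have h1 : MemLp (fun ω => oracle F (a ^ 2) (a ^ 3) (X ω) (S ω)) 2 μ :=
    (memLp_two_iff_integrable_sq_norm hcomp.aestronglyMeasurable).2
      (h.integrable_oracle_comp hXm hSm hS hind (by positivity)).1
  exact memLp_two_comp (hX.sub (h1.const_smul a)) (h.continuous_prox ha)
    (norm_sub_le_of_isProxPoint h.convex (by positivity) (by positivity) (h.isProxPoint_prox ha))

/-- The variance constant of the method. -/
noncomputable def varianceConst (n : ℕ) (L ρ ρbar : ℝ) : ℝ :=
  descentConst L ρ ρbar (gaussianMoment n 3)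
    + descentCoeff ρ ρbar * (L ^ 2 * gaussianMoment n 4)

lemma IsProblem.moreau_step_le (h : IsProblem P F r L ρ m) (hρbar : ρ < ρbar) {a : ℝ}
    (ha : 0 < a) (ha' : a < 1 / ρbar) {p : (𝔼 n) → 𝔼 n}
    (hp : ∀ x, IsProxPoint (fun x => smooth (expected P F) (a ^ 2) x + r x) ρbar x (p x))
    (x : 𝔼 n) (s : Ξ × (𝔼 n) × (𝔼 n)) :
    moreau (fun x => expected P F x + r x) ρbar (step F r a x s) ≤
      moreau (fun x => expected P F x + r x) ρbar x + 2 * (a ^ 2 * (L * gaussianMoment n 1))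
        - a * (ρbar - ρ) / (2 * ρbar) * ‖ρbar • (x - p x)‖ ^ 2
        + ρbar / 2 * gapWeight ρ ρbar a * modelGap (smooth (expected P F) (a ^ 2)) ρ
          (a ^ 3 * gaussianMoment n 3) L x (p x - x) (oracle F (a ^ 2) (a ^ 3) x s)
        + ρbar / 2 * a ^ 2 * (descentConst L ρ ρbar (gaussianMoment n 3) +
          descentCoeff ρ ρbar * ‖oracle F (a ^ 2) (a ^ 3) x s‖ ^ 2) := by
  have h0 : 0 < ρbar := h.pos.trans hρbar
  have hw : 0 ≤ a ^ 2 := by positivity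
  have e1 := h.moreau_objective_le h0 (step F r a x s) (p x)
  have e2 := (abs_le.1 (h.abs_smooth_sub_le hw (p x))).1
  have e3 := (hp x).moreau_eq
  have e4 := h.moreau_smoothed_le h0 hw x
  have e5 := prox_step h.nonneg h.pos hρbar (gaussianMoment_nonneg n 3)
    (h.weaklyConvex.smooth h.abs_expected_sub_le (a ^ 2))
    (abs_smooth_sub_smooth_le h.weaklyConvex.continuous h.abs_expected_sub_le _)
    h.convex ha ha' (hp x)
    (h.isProxPoint_prox ha (x - a • oracle F (a ^ 2) (a ^ 3) x s))
  change ‖step F r a x s - p x‖ ^ 2 ≤ _ at e5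
  -- The part `1` of the factor `1 - γ` rebuilds the envelope of the smoothed objective at `x`; the
  -- part `γ` becomes the squared gradient.
  have e6 := mul_le_mul_of_nonneg_left e5 (by positivity : 0 ≤ ρbar / 2)
  have e7 : a * (ρbar - ρ) / (2 * ρbar) * ‖ρbar • (x - p x)‖ ^ 2 =
      ρbar / 2 * (a * (ρbar - ρ) * ‖p x - x‖ ^ 2) := by
    rw [norm_smul, mul_pow, Real.norm_of_nonneg h0.le, norm_sub_rev x (p x)]
    field_simp
  rw [norm_sub_rev] at e1
  rw [e7]
  linarith

lemma IsProblem.integral_moreau_step_le (h : IsProblem P F r L ρ m) (hρbar : ρ < ρbar)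
    {X : Ω → 𝔼 n} {S : Ω → Ξ × (𝔼 n) × (𝔼 n)} (hXm : Measurable X) (hSm : Measurable S)
    (hS : μ.map S = sampleLaw n P) (hind : IndepFun X S μ) (hX : MemLp X 2 μ) {a : ℝ}
    (ha : 0 < a) (ha' : a < 1 / ρbar) :
    ∫ ω, moreau (fun x => expected P F x + r x) ρbar (step F r a (X ω) (S ω)) ∂μ ≤
      ∫ ω, moreau (fun x => expected P F x + r x) ρbar (X ω) ∂μ
        + 2 * (a ^ 2 * (L * gaussianMoment n 1))
        + varianceConst n L ρ ρbar * ρbar / 2 * a ^ 2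
        - a * (ρbar - ρ) / (2 * ρbar) * ∫ ω, ‖gradient
          (moreau (fun x => smooth (expected P F) (a ^ 2) x + r x) ρbar) (X ω)‖ ^ 2 ∂μ := by
  have h0 : 0 < ρbar := h.pos.trans hρbar
  have ha3 : 0 < a ^ 3 := by positivity
  obtain ⟨p, hp, hg, hc, hl⟩ := h.exists_gradient_moreau_smoothed hρbar (sq_nonneg a)
  have i1 := h.integrable_moreau_objective hρbar hX
  have i2 := h.integrable_gradient_sq hρbar (sq_nonneg a) hX
  have i3 := h.integrable_modelGap hXm hSm hS hind hX (u₁ := a ^ 2) ha3 hc hl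
    (a ^ 3 * gaussianMoment n 3)
  have l3 := h.integral_modelGap_nonpos hXm hSm hS hind hX (u₁ := a ^ 2) ha3 hc hl
  obtain ⟨i4, l4⟩ := h.integrable_oracle_comp hXm hSm hS hind (u₁ := a ^ 2) ha3
  have i5 := h.integrable_moreau_objective hρbar (h.memLp_step hXm hSm hS hind hX ha)
  simp_rw [fun x => (hg x).gradient] at i2 ⊢
  have hκ := gapWeight_nonneg h.pos hρbar ha
  have hcoef : 0 ≤ descentCoeff ρ ρbar := div_nonneg h0.le (slack_pos h.pos hρbar).le
  have j1 := i1.add (integrable_const (μ := μ) (2 * (a ^ 2 * (L * gaussianMoment n 1))))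
  have j2 := j1.sub (i2.const_mul (a * (ρbar - ρ) / (2 * ρbar)))
  have j3 := j2.add (i3.const_mul (ρbar / 2 * gapWeight ρ ρbar a))
  have k4 : Integrable (fun ω => descentConst L ρ ρbar (gaussianMoment n 3) +
      descentCoeff ρ ρbar * ‖oracle F (a ^ 2) (a ^ 3) (X ω) (S ω)‖ ^ 2) μ :=
    (integrable_const _).add (i4.const_mul (descentCoeff ρ ρbar))
  have hmono := integral_mono i5 (j3.add (k4.const_mul (ρbar / 2 * a ^ 2)))
    fun ω => h.moreau_step_le hρbar ha ha' hp (X ω) (S ω)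
  refine hmono.trans ?_
  rw [integral_add' j3 (k4.const_mul _), integral_add' j2 (i3.const_mul _),
    integral_sub' j1 (i2.const_mul _), integral_add' i1 (integrable_const _)]
  simp only [integral_const, probReal_univ, smul_eq_mul, one_mul]
  rw [integral_const_mul, integral_const_mul, integral_const_mul,
    integral_add (integrable_const _) (i4.const_mul _), integral_const_mul]
  simp only [integral_const, probReal_univ, smul_eq_mul, one_mul]
  have q1 := mul_le_mul_of_nonneg_left l3 (by positivity : 0 ≤ ρbar / 2 * gapWeight ρ ρbar a)
  have q2 := mul_le_mul_of_nonneg_left l4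
    (by positivity : 0 ≤ ρbar / 2 * a ^ 2 * descentCoeff ρ ρbar)
  unfold varianceConst
  linarith

end

/-! ### The random output index and telescoping. -/

lemma integral_random_index {Ω : Type*} [MeasurableSpace Ω] {μ : Measure Ω}
    [IsProbabilityMeasure μ] {Y : ℕ → Ω → ℝ} {s : Finset ℕ} (hY : ∀ t ∈ s, Integrable (Y t) μ)
    {τ : Ω → ℕ} (hτ : Measurable τ) {w : ℕ → ℝ} (hw : ∀ t ∈ s, 0 ≤ w t) (hsum : ∑ t ∈ s, w t = 1)
    (hlaw : ∀ t ∈ s, μ {ω | τ ω = t} = ENNReal.ofReal (w t))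
    (hind : ∀ t ∈ s, IndepFun τ (Y t) μ) :
    Integrable (fun ω => Y (τ ω) ω) μ ∧ ∫ ω, Y (τ ω) ω ∂μ = ∑ t ∈ s, w t * ∫ ω, Y t ω ∂μ := by
  have hset (t : ℕ) : MeasurableSet {ω | τ ω = t} := hτ (measurableSet_singleton t)
  -- The law is prescribed only on `s`; total mass one there excludes every other value almost
  -- surely.
  have hmem : ∀ᵐ ω ∂μ, τ ω ∈ s := by
    have h1 : {ω | τ ω ∈ s} = ⋃ t ∈ s, {ω | τ ω = t} := by ext; simp
    have h2 : μ {ω | τ ω ∈ s} = 1 := by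
      rw [h1, measure_biUnion_finset ?_ fun t _ => hset t, Finset.sum_congr rfl hlaw,
        ← ENNReal.ofReal_sum_of_nonneg hw, hsum, ENNReal.ofReal_one]
      intro i _ j _ hij
      refine Set.disjoint_left.2 fun ω hi hj => hij ?_
      exact Eq.trans (Eq.symm hi) hj
    exact (prob_compl_eq_zero_iff (hτ s.measurableSet)).2 h2
  have hae : (fun ω => Y (τ ω) ω) =ᵐ[μ] fun ω => ∑ t ∈ s, {ω | τ ω = t}.indicator (Y t) ω := by
    filter_upwards [hmem] with ω hω
    rw [Finset.sum_eq_single_of_mem _ hω]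
    · simp
    · intro t _ ht
      simp [ht.symm]
  have hi (t : ℕ) (ht : t ∈ s) : Integrable ({ω | τ ω = t}.indicator (Y t)) μ :=
    (hY t ht).indicator (hset t)
  refine ⟨(integrable_finsetSum s hi).congr hae.symm, ?_⟩
  rw [integral_congr_ae hae, integral_finsetSum s hi]
  refine Finset.sum_congr rfl fun t ht => ?_
  set q : ℕ → ℝ := ({t} : Set ℕ).indicator 1 with hq
  have hqm : Measurable q := measurable_of_countable q
  have h1 : IndepFun (fun ω => q (τ ω)) (Y t) μ := (hind t ht).comp hqm measurable_id
  have h2 : {ω | τ ω = t}.indicator (Y t) = fun ω => q (τ ω) * Y t ω := by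
    ext ω
    by_cases h : τ ω = t <;> simp [hq, h]
  have h3 : (fun ω => q (τ ω)) = {ω | τ ω = t}.indicator 1 := by
    ext ω
    by_cases h : τ ω = t <;> simp [hq, h]
  rw [h2, h1.integral_fun_mul_eq_mul_integral (hqm.comp hτ).aestronglyMeasurable (hY t ht).1, h3,
    integral_indicator_one (hset t), measureReal_def, hlaw t ht, ENNReal.toReal_ofReal (hw t ht)]

lemma weighted_sum_le {E G α : ℕ → ℝ} {C c m : ℝ}
    (hstep : ∀ t, E (t + 1) ≤ E t + C * α t ^ 2 - c * (α t * G t)) (hm : ∀ t, m ≤ E t) (T : ℕ) :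
    c * ∑ t ∈ Finset.range T, α t * G t ≤ E 0 - m + C * ∑ t ∈ Finset.range T, α t ^ 2 := by
  have key : E T + c * ∑ t ∈ Finset.range T, α t * G t ≤
      E 0 + C * ∑ t ∈ Finset.range T, α t ^ 2 := by
    induction T with
    | zero => simp
    | succ T ih =>
      rw [Finset.sum_range_succ, Finset.sum_range_succ]
      have := hstep T
      linarith
  have := hm T
  linarith

/-! ### Measurability, independence and integrability of the iterates. -/

section

variable {Ξ : Type*} [MeasurableSpace Ξ] {P : Measure Ξ} [IsProbabilityMeasure P]
  {F : (𝔼 n) → Ξ → ℝ} {r : (𝔼 n) → ℝ} {L ρ m ρbar : ℝ}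

/-- The σ-algebra is arbitrary and only samples before `t` enter. This serves both the σ-algebra
generated by the past, for independence from the next sample, and the space of sample sequences, for
independence from the output index. -/
lemma IsProblem.measurable_iterate (h : IsProblem P F r L ρ m) {α : ℕ → ℝ} (hα : ∀ t, 0 < α t)
    (x₀ : 𝔼 n) {Ω : Type*} {mΩ : MeasurableSpace Ω} {ξ : ℕ → Ω → Ξ} {Z₁ Z₂ : ℕ → Ω → 𝔼 n} (t : ℕ)
    (hS : ∀ i < t, Measurable fun ω => (ξ i ω, Z₁ i ω, Z₂ i ω)) :
    Measurable fun ω => iterate F r α x₀ (fun k => ξ k ω) (fun k => Z₁ k ω) (fun k => Z₂ k ω) t := by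
  induction t with
  | zero => exact measurable_const
  | succ t ih =>
    have h1 := ih fun i hi => hS i (hi.trans t.lt_succ_self)
    have := (h.measurable_step (hα t)).comp (h1.prodMk (hS t t.lt_succ_self))
    exact this

variable {Ω : Type*} [MeasurableSpace Ω] {μ : Measure Ω} {ξ : ℕ → Ω → Ξ} {Z₁ Z₂ : ℕ → Ω → 𝔼 n}

lemma IsProblem.indepFun_iterate (h : IsProblem P F r L ρ m) {α : ℕ → ℝ} (hα : ∀ t, 0 < α t)
    (x₀ : 𝔼 n) (hS : IsSampling μ P ξ Z₁ Z₂) (t : ℕ) :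
    IndepFun (fun ω => iterate F r α x₀ (fun k => ξ k ω) (fun k => Z₁ k ω) (fun k => Z₂ k ω) t)
      (fun ω => (ξ t ω, Z₁ t ω, Z₂ t ω)) μ := by
  have h1 := (iIndepFun_iff_iIndep _ _ _).1 hS.indep
  have h2 := indep_iSup_of_disjoint (fun i => (hS.measurable i).comap_le) h1
    (S := {i | i < t}) (T := {t}) (by simp)
  rw [iSup_singleton] at h2
  rw [IndepFun_iff_Indep]
  refine indep_of_indep_of_le_left h2 (Measurable.comap_le ?_)
  refine h.measurable_iterate hα x₀ t fun i hi => ?_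
  exact Measurable.mono (comap_measurable _)
    (le_iSup₂_of_le (f := fun i (_ : i ∈ {i | i < t}) => MeasurableSpace.comap
      (fun ω => (ξ i ω, Z₁ i ω, Z₂ i ω)) inferInstance) i hi le_rfl) le_rfl

lemma IsProblem.memLp_iterate [IsProbabilityMeasure μ] (h : IsProblem P F r L ρ m) {α : ℕ → ℝ}
    (hα : ∀ t, 0 < α t) (x₀ : 𝔼 n) (hS : IsSampling μ P ξ Z₁ Z₂) (t : ℕ) :
    MemLp (fun ω => iterate F r α x₀ (fun k => ξ k ω) (fun k => Z₁ k ω) (fun k => Z₂ k ω) t)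
      2 μ := by
  induction t with
  | zero => exact memLp_const x₀
  | succ t ih =>
    exact h.memLp_step (h.measurable_iterate hα x₀ t fun i _ => hS.measurable i)
      (hS.measurable t) (hS.law t) (h.indepFun_iterate hα x₀ hS t) ih (hα t)

end

lemma varianceConst_nonneg (n : ℕ) {L ρ ρbar : ℝ} (hL : 0 ≤ L) (hρ : 0 < ρ) (hρbar : ρ < ρbar) :
    0 ≤ varianceConst n L ρ ρbar := by
  have h0 : 0 < ρbar := hρ.trans hρbar
  have h1 := slack_pos hρ hρbar
  have h2 := gaussianMoment_nonneg n 3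
  have h3 := gaussianMoment_nonneg n 4
  unfold varianceConst descentConst descentCoeff
  positivity

end ZeroOrder

/-! ### The convergence theorem. -/

open ZeroOrder

/-- Convergence of the proximal stochastic derivative-free method. Here `f = expected P F` is the
expected function, `φ = f + r` the objective, `φu t = f_{u_{1,t}} + r` its smoothed version with
`u_{1,t} = (α t)²`, and `X t` the iterate of the method after `t` steps. -/
theorem theorem1 (n : ℕ) (L₀ ρ ρbar : ℝ) (hL₀ : 0 ≤ L₀) (hρ : 0 < ρ) (hρbar : ρ < ρbar) :
    ∃ Bbar : ℝ, 0 < Bbar ∧ ∃ B : ℝ, 0 < B ∧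
    ∀ (Ξ : Type u) [MeasurableSpace Ξ] (P : Measure Ξ) [IsProbabilityMeasure P]
      (F : EuclideanSpace ℝ (Fin n) → Ξ → ℝ) (r : EuclideanSpace ℝ (Fin n) → ℝ)
      (f φ : EuclideanSpace ℝ (Fin n) → ℝ),
      f = ZeroOrder.expected P F →
      φ = (fun x => f x + r x) →
      Measurable (Function.uncurry F) →
      (∀ x, Integrable (F x) P) →
      (∀ x y, Integrable (fun s => (F x s - F y s) ^ 2) P ∧
        ∫ s, (F x s - F y s) ^ 2 ∂P ≤ L₀ ^ 2 * ‖x - y‖ ^ 2) →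
      ConvexOn ℝ Set.univ (fun x => f x + ρ / 2 * ‖x‖ ^ 2) →
      ConvexOn ℝ Set.univ r →
      BddBelow (Set.range φ) →
      (∀ w, 0 < w → ∀ x, ZeroOrder.smooth f w x ≤ f x + w * Bbar * √((n : ℝ) + 2)) ∧
      ∀ (α : ℕ → ℝ) (x₀ : EuclideanSpace ℝ (Fin n)) (Ω : Type v) [MeasurableSpace Ω]
        (μ : Measure Ω) [IsProbabilityMeasure μ] (ξ : ℕ → Ω → Ξ)
        (Z₁ Z₂ : ℕ → Ω → EuclideanSpace ℝ (Fin n))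
        (φu : ℕ → EuclideanSpace ℝ (Fin n) → ℝ) (X : ℕ → Ω → EuclideanSpace ℝ (Fin n)),
        (∀ t, 0 < α t ∧ α t < min (1 / ρbar) ((ρbar - ρ) / 2)) →
        ZeroOrder.IsSampling μ P ξ Z₁ Z₂ →
        φu = (fun t x => ZeroOrder.smooth f (α t ^ 2) x + r x) →
        X = (fun t ω => ZeroOrder.iterate F r α x₀
          (fun k => ξ k ω) (fun k => Z₁ k ω) (fun k => Z₂ k ω) t) →
        (∀ t, Differentiable ℝ (ZeroOrder.moreau (φu t) ρbar)) ∧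
        (∀ t, Integrable (fun ω => ZeroOrder.moreau φ ρbar (X t ω)) μ) ∧
        (∀ t, Integrable
          (fun ω => ‖gradient (ZeroOrder.moreau (φu t) ρbar) (X t ω)‖ ^ 2) μ) ∧
        (∀ t, ∫ ω, ZeroOrder.moreau φ ρbar (X (t + 1) ω) ∂μ ≤
          ∫ ω, ZeroOrder.moreau φ ρbar (X t ω) ∂μ
            + α t ^ 2 * Bbar * √((n : ℝ) + 2) + B * ρbar / 2 * α t ^ 2
            - α t * (ρbar - ρ) / (2 * ρbar) *
              ∫ ω, ‖gradient (ZeroOrder.moreau (φu t) ρbar) (X t ω)‖ ^ 2 ∂μ) ∧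
        ∀ (T : ℕ) (τ : Ω → ℕ), ZeroOrder.IsOutputIndex μ ξ Z₁ Z₂ α T τ →
          Integrable
            (fun ω => ‖gradient (ZeroOrder.moreau (φu (τ ω)) ρbar) (X (τ ω) ω)‖ ^ 2) μ ∧
          ∫ ω, ‖gradient (ZeroOrder.moreau (φu (τ ω)) ρbar) (X (τ ω) ω)‖ ^ 2 ∂μ =
            1 / (∑ t ∈ Finset.range (T + 1), α t) *
              ∑ t ∈ Finset.range (T + 1),
                α t * ∫ ω, ‖gradient (ZeroOrder.moreau (φu t) ρbar) (X t ω)‖ ^ 2 ∂μ ∧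
          ∫ ω, ‖gradient (ZeroOrder.moreau (φu (τ ω)) ρbar) (X (τ ω) ω)‖ ^ 2 ∂μ ≤
            2 * ρbar / (ρbar - ρ) *
              ((φu 0 x₀ - (⨅ x, φ x)
                  + (Bbar * √((n : ℝ) + 2) + B * ρbar / 2) *
                    ∑ t ∈ Finset.range (T + 1), α t ^ 2) /
                ∑ t ∈ Finset.range (T + 1), α t) := by
  set M := gaussianMoment n 1 with hM
  have hM0 : 0 ≤ M := gaussianMoment_nonneg n 1
  have h0 : 0 < ρbar := hρ.trans hρbar
  have hm : 0 < ρbar - ρ := sub_pos.2 hρbar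
  have hV := varianceConst_nonneg n hL₀ hρ hρbar
  set V := varianceConst n L₀ ρ ρbar with hVdef
  have hroot : 1 ≤ √((n : ℝ) + 2) := by
    rw [Real.one_le_sqrt]
    have : (0 : ℝ) ≤ n := n.cast_nonneg
    linarith
  have hLM : 0 ≤ L₀ * M := mul_nonneg hL₀ hM0
  have hLMroot : L₀ * M ≤ (L₀ * M + 1) * √((n : ℝ) + 2) := by nlinarith
  have hB : (V + 4 * (L₀ * M) / ρbar + 1) * ρbar / 2 =
      V * ρbar / 2 + 2 * (L₀ * M) + ρbar / 2 := by
    field_simp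
    ring
  -- One smoothing error `L₀ M` is covered by `Bbar`; the term `4 L₀ M / ρbar` in `B` supplies two
  -- more. The final bound needs all three: two per step and one at the start. Adding `1` ensures
  -- positivity even when `L₀ = 0`.
  refine ⟨L₀ * M + 1, by positivity, V + 4 * (L₀ * M) / ρbar + 1, by positivity, ?_⟩
  intro Ξ _ P _ F r f φ hf hφ hmeas hint hlip hfconv hrconv hbdd
  subst hf hφ
  have h : IsProblem P F r L₀ ρ (⨅ x, (expected P F x + r x)) :=
    { nonneg := hL₀
      pos := hρ
      measurable := hmeas
      integrable := hint
      integrable_sq := fun x y => (hlip x y).1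
      lipschitz := fun x y => (hlip x y).2
      weaklyConvex := isWeaklyConvex_iff.2 hfconv
      convex := isWeaklyConvex_zero_iff.2 hrconv
      le := fun x => ciInf_le hbdd x }
  refine ⟨fun w hw x => ?_, ?_⟩
  · have e1 := (abs_le.1 (h.abs_smooth_sub_le hw.le x)).2
    have e2 := mul_le_mul_of_nonneg_left hLMroot hw.le
    linarith
  intro α x₀ Ω _ μ _ ξ Z₁ Z₂ φu X hα hS hφu hX
  have hαpos (t : ℕ) : 0 < α t := (hα t).1
  have hαlt (t : ℕ) : α t < 1 / ρbar := (hα t).2.trans_le (min_le_left _ _)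
  have hXm (t : ℕ) : Measurable (X t) := by
    rw [hX]; exact h.measurable_iterate hαpos x₀ t fun i _ => hS.measurable i
  have hX2 (t : ℕ) : MemLp (X t) 2 μ := by
    rw [hX]; exact h.memLp_iterate hαpos x₀ hS t
  have hXS (t : ℕ) : IndepFun (X t) (fun ω => (ξ t ω, Z₁ t ω, Z₂ t ω)) μ := by
    rw [hX]; exact h.indepFun_iterate hαpos x₀ hS t
  have hXstep (t : ℕ) : X (t + 1) = fun ω => step F r (α t) (X t ω) (ξ t ω, Z₁ t ω, Z₂ t ω) := by
    rw [hX]; rfl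
  have hdiff (t : ℕ) : Differentiable ℝ (moreau (φu t) ρbar) := by
    obtain ⟨p, -, hg, -⟩ := h.exists_gradient_moreau_smoothed hρbar (sq_nonneg (α t))
    rw [hφu]
    exact fun x => (hg x).differentiableAt
  have hgradm (t : ℕ) : Measurable (gradient (moreau (φu t) ρbar)) := by
    obtain ⟨p, -, hg, hc, -⟩ := h.exists_gradient_moreau_smoothed hρbar (sq_nonneg (α t))
    rw [hφu, gradient_eq hg]
    exact ((continuous_id.sub hc).const_smul ρbar).measurable
  have hmor (t : ℕ) := h.integrable_moreau_objective hρbar (hX2 t)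
  have hgrad (t : ℕ) :
      Integrable (fun ω => ‖gradient (moreau (φu t) ρbar) (X t ω)‖ ^ 2) μ := by
    rw [hφu]; exact h.integrable_gradient_sq hρbar (sq_nonneg (α t)) (hX2 t)
  have hdesc (t : ℕ) : ∫ ω, moreau (fun x => expected P F x + r x) ρbar (X (t + 1) ω) ∂μ ≤
      ∫ ω, moreau (fun x => expected P F x + r x) ρbar (X t ω) ∂μ
        + 2 * (α t ^ 2 * (L₀ * M)) + V * ρbar / 2 * α t ^ 2
        - α t * (ρbar - ρ) / (2 * ρbar) *
          ∫ ω, ‖gradient (moreau (φu t) ρbar) (X t ω)‖ ^ 2 ∂μ := by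
    rw [hXstep, hφu]
    exact h.integral_moreau_step_le hρbar (hXm t) (hS.measurable t) (hS.law t) (hXS t) (hX2 t)
      (hαpos t) (hαlt t)
  refine ⟨hdiff, hmor, hgrad, fun t => (hdesc t).trans ?_, fun T τ hτ => ?_⟩
  · have e1 := mul_le_mul_of_nonneg_left hLMroot (sq_nonneg (α t))
    have e2 : 0 ≤ ρbar / 2 * α t ^ 2 := by positivity
    have e3 : 0 ≤ α t ^ 2 * (L₀ * M) := by positivity
    rw [hB]
    linarith
  set A := ∑ t ∈ Finset.range (T + 1), α t with hA
  have hApos : 0 < A := Finset.sum_pos (fun t _ => hαpos t) (by simp)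
  have hindex := integral_random_index (Y := fun t ω => ‖gradient (moreau (φu t) ρbar) (X t ω)‖ ^ 2)
    (s := Finset.range (T + 1)) (fun t _ => hgrad t) hτ.measurable (w := fun t => α t / A)
    (fun t _ => div_nonneg (hαpos t).le hApos.le)
    (by rw [← Finset.sum_div, div_self hApos.ne']) hτ.law (fun t _ => ?_)
  swap
  -- The squared gradient at step `t` is a measurable function of the whole sample sequence, which
  -- is independent of the output index.
  · have hiter : Measurable fun s : ℕ → Ξ × EuclideanSpace ℝ (Fin n) × EuclideanSpace ℝ (Fin n) =>
        ‖gradient (moreau (φu t) ρbar) (iterate F r α x₀ (fun k => (s k).1)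
          (fun k => (s k).2.1) (fun k => (s k).2.2) t)‖ ^ 2 :=
      ((hgradm t).comp (h.measurable_iterate hαpos x₀ t
        fun i _ => measurable_pi_apply i)).norm.pow_const 2
    have := hτ.indep.comp measurable_id hiter
    rw [hX]
    exact this
  obtain ⟨hi, he⟩ := hindex
  have hsum : ∑ t ∈ Finset.range (T + 1), α t / A *
      ∫ ω, ‖gradient (moreau (φu t) ρbar) (X t ω)‖ ^ 2 ∂μ =
      1 / A * ∑ t ∈ Finset.range (T + 1),
        α t * ∫ ω, ‖gradient (moreau (φu t) ρbar) (X t ω)‖ ^ 2 ∂μ := by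
    rw [Finset.mul_sum]
    exact Finset.sum_congr rfl fun t _ => by ring
  rw [hsum] at he
  refine ⟨hi, he, ?_⟩
  rw [he]
  have hw := weighted_sum_le (m := ⨅ x, (expected P F x + r x))
    (E := fun t => ∫ ω, moreau (fun x => expected P F x + r x) ρbar (X t ω) ∂μ)
    (G := fun t => ∫ ω, ‖gradient (moreau (φu t) ρbar) (X t ω)‖ ^ 2 ∂μ) (α := α)
    (C := 2 * (L₀ * M) + V * ρbar / 2) (c := (ρbar - ρ) / (2 * ρbar))
    (fun t => (hdesc t).trans (le_of_eq (by ring)))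
    (fun t => by
      simpa using integral_mono (integrable_const _) (hmor t)
        fun ω => h.le_moreau_objective h0 (X t ω)) (T + 1)
  -- Passing from `φ` to its smoothing at `x₀` costs `α₀² L₀ M`, and `α₀²` is one term of the sum of
  -- squares.
  have hE0 : ∫ ω, moreau (fun x => expected P F x + r x) ρbar (X 0 ω) ∂μ ≤
      φu 0 x₀ + (L₀ * M) * ∑ t ∈ Finset.range (T + 1), α t ^ 2 := by
    have e1 : X 0 = fun _ => x₀ := by rw [hX]; rfl
    have e2 := h.moreau_objective_le h0 x₀ x₀
    have e3 := (abs_le.1 (h.abs_smooth_sub_le (sq_nonneg (α 0)) x₀)).1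
    have e4 : α 0 ^ 2 ≤ ∑ t ∈ Finset.range (T + 1), α t ^ 2 :=
      Finset.single_le_sum (f := fun t => α t ^ 2) (fun t _ => sq_nonneg (α t)) (by simp)
    have e5 := mul_le_mul_of_nonneg_left e4 hLM
    rw [e1, hφu]
    simp only [sub_self, norm_zero, integral_const, probReal_univ, one_smul] at e2 ⊢
    linarith
  have hQ : 0 ≤ ∑ t ∈ Finset.range (T + 1), α t ^ 2 := Finset.sum_nonneg fun t _ => sq_nonneg _
  rw [hB]
  generalize ∑ t ∈ Finset.range (T + 1), α t ^ 2 = Q at *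
  have hfin : (ρbar - ρ) / (2 * ρbar) * ∑ t ∈ Finset.range (T + 1),
      α t * ∫ ω, ‖gradient (moreau (φu t) ρbar) (X t ω)‖ ^ 2 ∂μ ≤
      φu 0 x₀ - (⨅ x, (expected P F x + r x)) + ((L₀ * M + 1) * √((n : ℝ) + 2) +
        (V * ρbar / 2 + 2 * (L₀ * M) + ρbar / 2)) * Q := by
    have e1 := mul_le_mul_of_nonneg_right hLMroot hQ
    have e2 : 0 ≤ ρbar / 2 * Q := by positivity
    linarith
  have hfin2 := mul_le_mul_of_nonneg_left hfin
    (by positivity : 0 ≤ 2 * ρbar / (ρbar - ρ) * (1 / A))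
  refine le_trans (le_of_eq ?_) (hfin2.trans (le_of_eq ?_))
  · generalize ∑ t ∈ Finset.range (T + 1), α t * ∫ ω, _ ∂μ = S
    field_simp
  · ring
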